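/- Let $n\ge 0$ and $d\ge 1$ be integers, let $(\Omega_i,\mu_i)$, $i=1,\dots,n$, be probability spaces, and let $\mu=\mu_1\otimes\cdots\otimes\mu_n$ be the product measure on $\Omega=\Omega_1\times\cdots\times\Omega_n$. Let $\mathbb{H}_d$ be the space of $d\times d$ complex Hermitian matrices, with smallest and largest eigenvalues $\lambda_{\min},\lambda_{\max}$ and with the $\ell_2$ operator norm $\|\cdot\|$. Let $f:\Omega\to\mathbb{H}_d$ be $\mu$-integrable (entrywise), with entrywise expectation $\mathbb{E}_\mu f$. For $z,w\in\Omega$ write $(z;w)_i=(z^1,\dots,z^{i-1},w^i,z^{i+1},\dots,z^n)$, and assume that, for $\mu$-almost every $z$, the random matrices $\big(f(z)-f((z;Z)_i)\big)^2$, $i=1,\dots,n$, with $Z\sim\mu$, are integrable (entrywise), so that the matrix $$V(f)(z)=\frac12\sum_{i=1}^n\mathbb{E}_{Z\sim\mu}\Big[\big(f(z)-f((z;Z)_i)\big)^2\Big]$$ is defined. Define $v_f=\big\|\,\|V(f)\|\,\big\|_{L_\infty(\mu)}\in[0,\infty]$. Then, for all $t\ge 0$, $$\mathbb{P}_\mu\{\lambda_{\max}(f-\mathbb{E}_\mu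 f)\ge t\}\le d\cdot\exp\Big(-\frac{t^2}{4v_f}\Big),\qquad \mathbb{P}_\mu\{\lambda_{\min}(f-\mathbb{E}_\mu f)\le -t\}\le d\cdot\exp\Big(-\frac{t^2}{4v_f}\Big).$$ Furthermore, $\lambda_{\max}(f-\mathbb{E}_\mu f)$ and $\lambda_{\min}(f-\mathbb{E}_\mu f)$ are $\mu$-integrable, and $$\mathbb{E}_\mu\lambda_{\max}(f-\mathbb{E}_\mu f)\le 2\sqrt{v_f\log d},\qquad \mathbb{E}_\mu\lambda_{\min}(f-\mathbb{E}_\mu f)\ge -2\sqrt{v_f\log d}.$$ Here $t^2/\infty=0$, $t^2/0=\infty$ for $t>0$, $0/0=0$, $\exp(-\infty)=0$, and $\infty\cdot 0=0$. -/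

import Mathlib

open MeasureTheory
open scoped ENNReal

noncomputable section

namespace ProductMatrix

/-- The largest eigenvalue of a Hermitian matrix: the maximum of its (real) spectrum. -/
def lambdaMax {d : ℕ} (A : Matrix (Fin d) (Fin d) ℂ) : ℝ :=
  sSup (spectrum ℝ A)

/-- The smallest eigenvalue of a Hermitian matrix: the minimum of its (real) spectrum. -/
def lambdaMin {d : ℕ} (A : Matrix (Fin d) (Fin d) ℂ) : ℝ :=
  sInf (spectrum ℝ A)

/-- The entrywise expectation of a random matrix. -/
def expect {d : ℕ} {Ω : Type*} [MeasurableSpace Ω] (μ : Measure Ω)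
    (X : Ω → Matrix (Fin d) (Fin d) ℂ) : Matrix (Fin d) (Fin d) ℂ :=
  Matrix.of fun a b => ∫ z, X z a b ∂μ

/-- The entrywise integrability of a random matrix. -/
def EntryIntegrable {d : ℕ} {Ω : Type*} [MeasurableSpace Ω] (μ : Measure Ω)
    (X : Ω → Matrix (Fin d) (Fin d) ℂ) : Prop :=
  ∀ a b, Integrable (fun z => X z a b) μ

variable {n d : ℕ} {Ω : Fin n → Type*} [∀ i, MeasurableSpace (Ω i)]

/-- The squared increment `(f(z) - f((z;w)_i))²`, where `(z;w)_i` is `z` with its `i`-th coordinate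
replaced by that of `w`. -/
def sqIncrement (f : (∀ i, Ω i) → Matrix (Fin d) (Fin d) ℂ) (i : Fin n) (z w : ∀ i, Ω i) :
    Matrix (Fin d) (Fin d) ℂ :=
  (f z - f (Function.update z i (w i))) ^ 2

/-- The matrix variance proxy
`V(f)(z) = (1/2) ∑ᵢ E_Z (f(z) - f((z;Z)_i))²` with `Z` distributed as `⨂ᵢ μᵢ`. -/
def varianceMatrix (μ : ∀ i, Measure (Ω i)) (f : (∀ i, Ω i) → Matrix (Fin d) (Fin d) ℂ)
    (z : ∀ i, Ω i) : Matrix (Fin d) (Fin d) ℂ :=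
  (1 / 2 : ℂ) • ∑ i, expect (Measure.pi μ) (fun w => sqIncrement f i z w)

/-- The scalar variance proxy `v_f`: the essential supremum, in `[0, ∞]`, of the `ℓ₂` operator norm
of `V(f)`. -/
def varianceProxy (μ : ∀ i, Measure (Ω i)) (f : (∀ i, Ω i) → Matrix (Fin d) (Fin d) ℂ) : ℝ≥0∞ :=
  essSup (fun z => ‖Matrix.toEuclideanCLM (n := Fin d) (𝕜 := ℂ) (varianceMatrix μ f z)‖ₑ)
    (Measure.pi μ)

/-- The tail bound `d · exp(-t² / (4v)) ∈ [0, ∞]` for `t ≥ 0` and `v ∈ [0, ∞]`. The division is that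
of `[0, ∞]`, so `t² / ∞ = 0`, and `t² / 0 = ∞` for `t > 0` (where the bound is `d · exp(-∞) = 0`),
and `0 / 0 = 0`. -/
def tailBound (d : ℕ) (v : ℝ≥0∞) (t : ℝ) : ℝ≥0∞ :=
  d * EReal.exp (-((ENNReal.ofReal (t ^ 2) / (4 * v) : ℝ≥0∞) : EReal))

/-- The expectation bound `2 √(v log d) ∈ [0, ∞]` for `d ≥ 1` and `v ∈ [0, ∞]`, with `∞ · 0 = 0`. -/
def expectationBound (d : ℕ) (v : ℝ≥0∞) : ℝ≥0∞ :=
  2 * (v * ENNReal.ofReal (Real.log d)) ^ (1 / 2 : ℝ)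

end ProductMatrix

end

/-! By the matrix Laplace transform method it suffices to bound `m(θ) = E tr exp(θ(f - E f))`. Its
derivative is `E tr((f - E f) exp(θ(f - E f)))`, and the core of the proof is the differential
inequality `m' ≤ 2vθ m` for bounded `f` (`integral_re_trace_mul_exp_le`). It integrates to `m(θ) ≤ d
exp(vθ²)`; optimizing over `θ` yields both bounds.

For the core estimate, let `w` be an independent copy of `z`, and let `z_S` be `z` with the
coordinates in `S` taken from `w`. The difference `f(z) - f(w)` is averaged over all orders of
replacing coordinates (`sub_eq_sum_shapleyWeight`), which gives increments `f(z_S) - f(z_{S ∪ i})`.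
Exchanging `z^i` and `w^i` preserves the joint law and reverses such an increment, so only the
difference of two exponentials matters. A mean value trace inequality
(`re_trace_mul_exp_sub_exp_le`) bounds it by two energies, one with the squared increment at `S` and
one with that at `∅`, with a free weight `s` on the first and `s⁻¹` on the second. For each `S` the
energies sum over `i ∉ S` to at most `2 v m` (`sum_resampledEnergy_le`).

The weight `s` depends on `|S|`. With `s = 1` the energies at `S` would carry the total Shapley
weight `∑ 1/(n - k)`, of order `log n`. With `s = √((n - k)/n)` both totals become `n^{-1/2} ∑ (n -
k)^{-1/2} ≤ 2`, and the dimension-free constant follows.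

General `f` reduces to bounded `f`: a finite `v` bounds the conditional mean increments, and `n`
successive replacements then bound `f` almost everywhere (`exists_bounded_version`). Infinite `v` is
trivial, except for the expectation when `d = 1`, where that expectation is zero. The smallest
eigenvalue is handled by `-f`. -/

namespace ProductMatrix

open scoped Matrix Matrix.Norms.L2Operator

/-! ### Spectral calculus and trace inequalities for Hermitian matrices. -/

section MatrixAnalysis

variable {d : ℕ}

/-- Simultaneous spectral resolution of a Hermitian matrix and its exponentials. -/
theorem exists_spectral_resolution {A : Matrix (Fin d) (Fin d) ℂ} (hA : A.IsHermitian) :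
    ∃ P : Matrix (Fin d) (Fin d) ℂ, Pᴴ * P = 1 ∧ P * Pᴴ = 1 ∧
      (∀ θ : ℝ, θ • A = P * Matrix.diagonal (fun i => ((θ * hA.eigenvalues i : ℝ) : ℂ)) * Pᴴ) ∧
      ∀ θ : ℝ, NormedSpace.exp (θ • A) =
        P * Matrix.diagonal (fun i => ((Real.exp (θ * hA.eigenvalues i) : ℝ) : ℂ)) * Pᴴ := by
  set P : Matrix (Fin d) (Fin d) ℂ := ↑hA.eigenvectorUnitary with hP
  have h1 : Pᴴ * P = 1 := Unitary.coe_star_mul_self hA.eigenvectorUnitary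
  have h2 : P * Pᴴ = 1 := Unitary.coe_mul_star_self hA.eigenvectorUnitary
  have h3 : ∀ θ : ℝ, θ • A =
      P * Matrix.diagonal (fun i => ((θ * hA.eigenvalues i : ℝ) : ℂ)) * Pᴴ := by
    intro θ
    conv_lhs => rw [hA.spectral_theorem, Unitary.conjStarAlgAut_apply]
    have : Matrix.diagonal (fun i => ((θ * hA.eigenvalues i : ℝ) : ℂ)) =
        θ • Matrix.diagonal (RCLike.ofReal ∘ hA.eigenvalues : Fin d → ℂ) := by
      rw [← Matrix.diagonal_smul]
      congr 1
      ext i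
      simp
    rw [this, Matrix.mul_smul, Matrix.smul_mul]
    rfl
  refine ⟨P, h1, h2, h3, fun θ => ?_⟩
  let u : (Matrix (Fin d) (Fin d) ℂ)ˣ := ⟨P, Pᴴ, h2, h1⟩
  have := Matrix.exp_units_conj u
    (Matrix.diagonal (fun i => ((θ * hA.eigenvalues i : ℝ) : ℂ)))
  rw [h3 θ]
  refine this.trans ?_
  rw [Matrix.exp_diagonal]
  congr 3
  ext i
  simp [Pi.coe_exp, ← Complex.exp_eq_exp_ℂ]

theorem trace_conjTranspose_mul (M N : Matrix (Fin d) (Fin d) ℂ) :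
    (Mᴴ * N).trace = ∑ i, ∑ j, star (M i j) * N i j := by
  simp only [Matrix.trace, Matrix.diag, Matrix.mul_apply, Matrix.conjTranspose_apply]
  exact Finset.sum_comm

/-- The exponential is convex, so its mean over an interval is at most the average of its endpoint
values (Hermite–Hadamard). -/
theorem abs_exp_sub_exp_le (a b : ℝ) :
    |Real.exp a - Real.exp b| ≤ |a - b| * ((Real.exp a + Real.exp b) / 2) := by
  wlog h : b ≤ a generalizing a b
  · rw [abs_sub_comm, abs_sub_comm a, add_comm]
    exact this b a (le_of_not_ge h)
  rw [abs_of_nonneg (sub_nonneg.2 (Real.exp_le_exp.2 h)), abs_of_nonneg (sub_nonneg.2 h)]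
  have key : ∀ x : ℝ, 0 ≤ x → Real.exp x - 1 ≤ x * ((Real.exp x + 1) / 2) := by
    intro x hx
    have hm : MonotoneOn (fun x : ℝ => x * ((Real.exp x + 1) / 2) - (Real.exp x - 1))
        (Set.Ici 0) := by
      apply monotoneOn_of_deriv_nonneg (convex_Ici 0) (by fun_prop) (by fun_prop)
      intro y hy
      have hd : HasDerivAt (fun x : ℝ => x * ((Real.exp x + 1) / 2) - (Real.exp x - 1))
          (1 * ((Real.exp y + 1) / 2) + y * (Real.exp y / 2) - Real.exp y) y :=
        ((hasDerivAt_id y).mul (((Real.hasDerivAt_exp y).add_const 1).div_const 2)).sub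
          ((Real.hasDerivAt_exp y).sub_const 1)
      rw [hd.deriv]
      -- The derivative equals `e^y (e^{-y} - 1 + y) / 2`.
      have h1 := Real.add_one_le_exp (-y)
      have h2 : Real.exp y * Real.exp (-y) = 1 := by rw [← Real.exp_add]; simp
      nlinarith [Real.exp_pos y]
    have := hm (Set.mem_Ici.2 le_rfl) (Set.mem_Ici.2 hx) hx
    simp at this
    linarith
  have := key (a - b) (sub_nonneg.2 h)
  have e : Real.exp a = Real.exp b * Real.exp (a - b) := by rw [← Real.exp_add]; ring_nf
  rw [e]
  nlinarith [Real.exp_pos b]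

/-- The second basis `Q` plays no role on the left-hand side. It is inserted so that traces against
functions of two non-commuting matrices are expressed through the same mixed entries `(Pᴴ M
Q)_{ij}`. -/
theorem re_trace_sq_mul_diagonal_left {P Q M : Matrix (Fin d) (Fin d) ℂ} (hM : M.IsHermitian)
    (hQ : Q * Qᴴ = 1) (D : Fin d → ℝ) :
    (M ^ 2 * (P * Matrix.diagonal (fun i => (D i : ℂ)) * Pᴴ)).trace.re =
      ∑ i, ∑ j, D i * Complex.normSq ((Pᴴ * M * Q) i j) := by
  have h : (M ^ 2 * (P * Matrix.diagonal (fun i => (D i : ℂ)) * Pᴴ)).trace =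
      ((Pᴴ * M * Q)ᴴ * (Matrix.diagonal (fun i => (D i : ℂ)) * (Pᴴ * M * Q))).trace := by
    calc _ = ((M * P * Matrix.diagonal (fun i => (D i : ℂ)) * Pᴴ) * M * (Q * Qᴴ)).trace := by
            rw [hQ, Matrix.mul_one, Matrix.trace_mul_comm _ M, pow_two]
            simp only [Matrix.mul_assoc]
      _ = ((M * P * Matrix.diagonal (fun i => (D i : ℂ)) * Pᴴ * M * Q) * Qᴴ).trace := by
            simp only [Matrix.mul_assoc]
      _ = _ := by
            rw [Matrix.trace_mul_comm]
            simp only [Matrix.conjTranspose_mul, Matrix.conjTranspose_conjTranspose, hM.eq,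
              Matrix.mul_assoc]
  rw [h, trace_conjTranspose_mul]
  simp only [Complex.re_sum, Matrix.diagonal_mul]
  refine Finset.sum_congr rfl fun i _ => Finset.sum_congr rfl fun j _ => ?_
  simp [Complex.normSq_apply]
  ring

theorem re_trace_sq_mul_diagonal_right {P Q M : Matrix (Fin d) (Fin d) ℂ} (hM : M.IsHermitian)
    (hP : P * Pᴴ = 1) (D : Fin d → ℝ) :
    (M ^ 2 * (Q * Matrix.diagonal (fun i => (D i : ℂ)) * Qᴴ)).trace.re =
      ∑ i, ∑ j, D j * Complex.normSq ((Pᴴ * M * Q) i j) := by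
  rw [re_trace_sq_mul_diagonal_left hM hP, Finset.sum_comm]
  refine Finset.sum_congr rfl fun i _ => Finset.sum_congr rfl fun j _ => ?_
  have : Pᴴ * M * Q = (Qᴴ * M * P)ᴴ := by
    simp [Matrix.conjTranspose_mul, hM.eq, Matrix.mul_assoc]
  rw [this, Matrix.conjTranspose_apply, Complex.star_def, Complex.normSq_conj]

/-- The mean value trace inequality for the exponential. -/
theorem re_trace_mul_exp_sub_exp_le {U A B : Matrix (Fin d) (Fin d) ℂ} (hU : U.IsHermitian)
    (hA : A.IsHermitian) (hB : B.IsHermitian) {s : ℝ} (hs : 0 < s) :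
    4 * (U * (NormedSpace.exp A - NormedSpace.exp B)).trace.re ≤
      s * (U ^ 2 * NormedSpace.exp A).trace.re + s * (U ^ 2 * NormedSpace.exp B).trace.re +
      (s⁻¹ * ((A - B) ^ 2 * NormedSpace.exp A).trace.re +
        s⁻¹ * ((A - B) ^ 2 * NormedSpace.exp B).trace.re) := by
  obtain ⟨P, hP1, hP2, hA1, hA2⟩ := exists_spectral_resolution hA
  obtain ⟨Q, hQ1, hQ2, hB1, hB2⟩ := exists_spectral_resolution hB
  have hAe := hA2 1
  have hBe := hB2 1
  have hAs := hA1 1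
  have hBs := hB1 1
  simp only [one_smul, one_mul] at hAe hBe hAs hBs
  set a := hA.eigenvalues
  set b := hB.eigenvalues
  have hAB : (A - B).IsHermitian := hA.sub hB
  have conj_diag : ∀ x y : Fin d → ℂ, ∀ i j,
      (Pᴴ * (P * Matrix.diagonal x * Pᴴ - Q * Matrix.diagonal y * Qᴴ) * Q) i j =
        (x i - y j) * (Pᴴ * Q) i j := by
    intro x y i j
    have : Pᴴ * (P * Matrix.diagonal x * Pᴴ - Q * Matrix.diagonal y * Qᴴ) * Q =
        (Pᴴ * P) * (Matrix.diagonal x * (Pᴴ * Q)) -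
          (Pᴴ * Q) * Matrix.diagonal y * (Qᴴ * Q) := by
      simp only [Matrix.mul_sub, Matrix.sub_mul, Matrix.mul_assoc]
    rw [this, hP1, hQ1, Matrix.one_mul, Matrix.mul_one, Matrix.sub_apply, Matrix.diagonal_mul,
      Matrix.mul_diagonal]
    ring
  have htr : (U * (NormedSpace.exp A - NormedSpace.exp B)).trace =
      ((Pᴴ * U * Q)ᴴ * (Pᴴ * (NormedSpace.exp A - NormedSpace.exp B) * Q)).trace := by
    have : (Pᴴ * U * Q)ᴴ * (Pᴴ * (NormedSpace.exp A - NormedSpace.exp B) * Q) =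
        Qᴴ * (U * (P * Pᴴ) * (NormedSpace.exp A - NormedSpace.exp B) * Q) := by
      simp only [Matrix.conjTranspose_mul, Matrix.conjTranspose_conjTranspose, hU.eq,
        Matrix.mul_assoc]
    rw [this, Matrix.trace_mul_comm Qᴴ, hP2, Matrix.mul_one, Matrix.mul_assoc, Matrix.mul_assoc,
      hQ2, Matrix.mul_one]
  rw [htr, trace_conjTranspose_mul]
  have hAB' : A - B = P * Matrix.diagonal (fun i => (a i : ℂ)) * Pᴴ -
      Q * Matrix.diagonal (fun i => (b i : ℂ)) * Qᴴ := by rw [← hAs, ← hBs]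
  rw [hAe, hBe, re_trace_sq_mul_diagonal_left hU hQ2, re_trace_sq_mul_diagonal_right hU hP2,
    re_trace_sq_mul_diagonal_left hAB hQ2, re_trace_sq_mul_diagonal_right hAB hP2]
  simp only [Complex.re_sum, Finset.mul_sum, ← Finset.sum_add_distrib]
  -- In the mixed eigenbasis the claim holds entry by entry: the scalar mean value bound, then `2xy
  -- ≤ s x² + s⁻¹ y²`.
  refine Finset.sum_le_sum fun i _ => Finset.sum_le_sum fun j _ => ?_
  rw [hAB', conj_diag, conj_diag]
  set u := (Pᴴ * U * Q) i j
  set w := (Pᴴ * Q) i j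
  have hn := abs_exp_sub_exp_le (a i) (b j)
  have e1 : (star u * (((Real.exp (a i) : ℝ) : ℂ) - ((Real.exp (b j) : ℝ) : ℂ)) * w).re ≤
      ‖u‖ * (|Real.exp (a i) - Real.exp (b j)| * ‖w‖) := by
    refine (Complex.re_le_norm _).trans ?_
    rw [← Complex.ofReal_sub, norm_mul, norm_mul, Complex.norm_real, norm_star, mul_assoc]
    rfl
  have e2 : Complex.normSq (((a i : ℂ) - (b j : ℂ)) * w) = (|a i - b j| * ‖w‖) ^ 2 := by
    rw [← Complex.ofReal_sub, Complex.normSq_eq_norm_sq, norm_mul, Complex.norm_real]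
    rfl
  rw [e2, Complex.normSq_eq_norm_sq, ← mul_assoc]
  set x := ‖u‖
  set y := |a i - b j| * ‖w‖ with hy
  set E := Real.exp (a i) + Real.exp (b j) with hE
  have hEpos : 0 < E := by positivity
  have e3 : x * (|Real.exp (a i) - Real.exp (b j)| * ‖w‖) ≤ x * y * (E / 2) := by
    have : |Real.exp (a i) - Real.exp (b j)| * ‖w‖ ≤ y * (E / 2) := by
      rw [hy, mul_right_comm]
      exact mul_le_mul_of_nonneg_right hn (norm_nonneg _)
    rw [mul_assoc]
    exact mul_le_mul_of_nonneg_left this (norm_nonneg _)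
  have e4 : 2 * (x * y) ≤ s * x ^ 2 + s⁻¹ * y ^ 2 := by
    have : 0 ≤ s⁻¹ * (s * x - y) ^ 2 := by positivity
    have e : s⁻¹ * (s * x - y) ^ 2 = s * x ^ 2 + s⁻¹ * y ^ 2 - 2 * (x * y) := by
      field_simp
      ring
    linarith
  have e5 : s * (Real.exp (a i) * x ^ 2) + s * (Real.exp (b j) * x ^ 2) +
      (s⁻¹ * (Real.exp (a i) * y ^ 2) + s⁻¹ * (Real.exp (b j) * y ^ 2)) =
      E * (s * x ^ 2 + s⁻¹ * y ^ 2) := by rw [hE]; ring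
  rw [e5]
  nlinarith [mul_le_mul_of_nonneg_left e4 hEpos.le]

theorem re_trace_exp_eq_sum {A : Matrix (Fin d) (Fin d) ℂ} (hA : A.IsHermitian) (θ : ℝ) :
    (NormedSpace.exp (θ • A)).trace.re = ∑ i, Real.exp (θ * hA.eigenvalues i) := by
  obtain ⟨P, hP1, hP2, -, hA2⟩ := exists_spectral_resolution hA
  rw [hA2, Matrix.trace_mul_comm, ← Matrix.mul_assoc, hP1, Matrix.one_mul, Matrix.trace_diagonal,
    Complex.re_sum]
  simp only [Complex.ofReal_re]

theorem lambdaMax_mem {A : Matrix (Fin d) (Fin d) ℂ} (hd : 1 ≤ d) (hA : A.IsHermitian) :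
    ∃ i, lambdaMax A = hA.eigenvalues i ∧ ∀ j, hA.eigenvalues j ≤ lambdaMax A := by
  have : Nonempty (Fin d) := ⟨⟨0, hd⟩⟩
  obtain ⟨i, hi⟩ := Finite.exists_max hA.eigenvalues
  have : lambdaMax A = hA.eigenvalues i := by
    rw [lambdaMax, hA.spectrum_real_eq_range_eigenvalues]
    exact (IsGreatest.csSup_eq ⟨⟨i, rfl⟩, by rintro _ ⟨j, rfl⟩; exact hi j⟩)
  exact ⟨i, this, fun j => this ▸ hi j⟩

theorem exp_lambdaMax_le_trace {A : Matrix (Fin d) (Fin d) ℂ} (hd : 1 ≤ d) (hA : A.IsHermitian)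
    (θ : ℝ) : Real.exp (θ * lambdaMax A) ≤ (NormedSpace.exp (θ • A)).trace.re := by
  obtain ⟨i, hi, -⟩ := lambdaMax_mem hd hA
  rw [re_trace_exp_eq_sum hA, hi]
  exact Finset.single_le_sum (f := fun i => Real.exp (θ * hA.eigenvalues i))
    (fun j _ => (Real.exp_pos _).le) (Finset.mem_univ i)

theorem trace_exp_le_exp_lambdaMax {A : Matrix (Fin d) (Fin d) ℂ} (hd : 1 ≤ d)
    (hA : A.IsHermitian) {θ : ℝ} (hθ : 0 ≤ θ) :
    (NormedSpace.exp (θ • A)).trace.re ≤ d * Real.exp (θ * lambdaMax A) := by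
  obtain ⟨-, -, hi⟩ := lambdaMax_mem hd hA
  rw [re_trace_exp_eq_sum hA]
  refine (Finset.sum_le_card_nsmul _ _ (Real.exp (θ * lambdaMax A)) fun j _ => ?_).trans
    (by simp)
  exact Real.exp_le_exp.2 (mul_le_mul_of_nonneg_left (hi j) hθ)

theorem lambdaMin_eq_neg (A : Matrix (Fin d) (Fin d) ℂ) : lambdaMin A = - lambdaMax (-A) := by
  rw [lambdaMin, lambdaMax, ← spectrum.neg_eq, Real.sInf_def]

theorem lambdaMax_fin_one {A : Matrix (Fin 1) (Fin 1) ℂ} (hA : A.IsHermitian) :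
    lambdaMax A = (A 0 0).re := by
  obtain ⟨i, hi, -⟩ := lambdaMax_mem le_rfl hA
  have := hA.trace_eq_sum_eigenvalues
  rw [Subsingleton.elim i 0] at hi
  simp [Matrix.trace] at this
  simp [hi, this]

theorem abs_lambdaMax_le_norm {A : Matrix (Fin d) (Fin d) ℂ} (hd : 1 ≤ d) (hA : A.IsHermitian) :
    |lambdaMax A| ≤ ‖A‖ := by
  have : Nonempty (Fin d) := ⟨⟨0, hd⟩⟩
  obtain ⟨i, hi, -⟩ := lambdaMax_mem hd hA
  have := spectrum.norm_le_norm_of_mem (hA.eigenvalues_mem_spectrum_real i)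
  rwa [← hi] at this

theorem norm_apply_le_norm (A : Matrix (Fin d) (Fin d) ℂ) (i j : Fin d) : ‖A i j‖ ≤ ‖A‖ := by
  have h := A.l2_opNorm_mulVec (EuclideanSpace.single j (1 : ℂ))
  rw [PiLp.norm_single, norm_one, mul_one] at h
  refine le_trans ?_ h
  refine le_trans (le_of_eq ?_) (PiLp.norm_apply_le _ i)
  simp

/-- `tr (V G) ≤ ‖V‖ tr G` for a matrix exponential `G`. -/
theorem re_trace_mul_exp_le {V A : Matrix (Fin d) (Fin d) ℂ} (hA : A.IsHermitian) {v : ℝ}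
    (hV : ‖Matrix.toEuclideanCLM (n := Fin d) (𝕜 := ℂ) V‖ ≤ v) :
    (V * NormedSpace.exp A).trace.re ≤ v * (NormedSpace.exp A).trace.re := by
  obtain ⟨P, hP1, hP2, -, hA2⟩ := exists_spectral_resolution hA
  have h1 := hA2 1
  have h2 := re_trace_exp_eq_sum hA 1
  simp only [one_smul, one_mul] at h1 h2
  rw [h2, h1, ← Matrix.mul_assoc, Matrix.trace_mul_comm, ← Matrix.mul_assoc, ← Matrix.mul_assoc,
    Matrix.trace, Complex.re_sum, Finset.mul_sum]
  refine Finset.sum_le_sum fun i _ => ?_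
  rw [Matrix.diag, Matrix.mul_diagonal]
  have hle : ((Pᴴ * V * P) i i).re ≤ v := by
    have hP : P ∈ unitary (Matrix (Fin d) (Fin d) ℂ) := Unitary.mem_iff.2 ⟨hP1, hP2⟩
    have hP' : Pᴴ ∈ unitary (Matrix (Fin d) (Fin d) ℂ) := Unitary.star_mem hP
    refine (Complex.re_le_norm _).trans ((norm_apply_le_norm _ i i).trans ?_)
    rwa [CStarRing.norm_mul_mem_unitary _ hP, CStarRing.norm_mem_unitary_mul _ hP',
      Matrix.cstar_norm_def]
  have : ((Pᴴ * V * P) i i * ((Real.exp (hA.eigenvalues i) : ℝ) : ℂ)).re =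
      ((Pᴴ * V * P) i i).re * Real.exp (hA.eigenvalues i) := by
    rw [Complex.re_mul_ofReal]
  rw [this]
  exact mul_le_mul_of_nonneg_right hle (Real.exp_pos _).le

end MatrixAnalysis

/-! ### Resampling coordinates from an independent copy. -/

section Resampling

variable {n : ℕ} {Ω : Fin n → Type*}

theorem finset_piecewise_singleton_update (S : Finset (Fin n)) {i : Fin n} (hi : i ∉ S)
    (z w w' : ∀ i, Ω i) :
    S.piecewise (({i} : Finset (Fin n)).piecewise w' w) z = S.piecewise w z := by
  ext j
  by_cases h : j ∈ S
  · have : j ≠ i := fun e => hi (e ▸ h)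
    simp [h, this]
  · simp [h]

variable [∀ i, MeasurableSpace (Ω i)]

theorem measurable_finset_piecewise (S : Finset (Fin n)) :
    Measurable (fun p : (∀ i, Ω i) × (∀ i, Ω i) => S.piecewise p.2 p.1) := by
  refine measurable_pi_lambda _ fun i => ?_
  by_cases h : i ∈ S
  · simp only [h, Finset.piecewise_eq_of_mem]
    fun_prop
  · simp only [h, not_false_eq_true, Finset.piecewise_eq_of_notMem]
    fun_prop

variable (μ : ∀ i, Measure (Ω i)) [∀ i, IsProbabilityMeasure (μ i)]

/-- Exchanging the coordinates in `S` of two independent samples preserves their joint law. -/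
theorem measurePreserving_swap (S : Finset (Fin n)) :
    MeasurePreserving (fun p : (∀ i, Ω i) × (∀ i, Ω i) =>
      (S.piecewise p.2 p.1, S.piecewise p.1 p.2))
      ((Measure.pi μ).prod (Measure.pi μ)) ((Measure.pi μ).prod (Measure.pi μ)) := by
  have hm : Measurable (fun p : (∀ i, Ω i) × (∀ i, Ω i) =>
      (S.piecewise p.2 p.1, S.piecewise p.1 p.2)) :=
    (measurable_finset_piecewise S).prodMk ((measurable_finset_piecewise S).comp measurable_swap)
  refine ⟨hm, ?_⟩
  have hspan : (Measure.pi μ).FiniteSpanningSetsIn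
      (Set.pi Set.univ '' Set.pi Set.univ fun i => {s : Set (Ω i) | MeasurableSet s}) :=
    { set := fun _ => Set.univ
      set_mem := fun _ => ⟨fun _ => Set.univ, by simp, by simp⟩
      finite := fun _ => measure_lt_top _ _
      spanning := Set.iUnion_const _ }
  symm
  refine Measure.prod_eq_generateFrom generateFrom_pi generateFrom_pi isPiSystem_pi isPiSystem_pi
    hspan hspan ?_
  rintro _ ⟨s, hs, rfl⟩ _ ⟨t, ht, rfl⟩
  have hs' : ∀ i, MeasurableSet (s i) := fun i => hs i trivial
  have ht' : ∀ i, MeasurableSet (t i) := fun i => ht i trivial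
  -- On rectangles the exchange swaps the factors `s i` and `t i` for `i ∈ S`, which leaves the
  -- product of the measures unchanged.
  have hpre : (fun p : (∀ i, Ω i) × (∀ i, Ω i) => (S.piecewise p.2 p.1, S.piecewise p.1 p.2)) ⁻¹'
      (Set.univ.pi s ×ˢ Set.univ.pi t) =
      (Set.univ.pi (S.piecewise t s)) ×ˢ (Set.univ.pi (S.piecewise s t)) := by
    ext p
    simp only [Set.mem_preimage, Set.mem_prod, Set.mem_pi, Set.mem_univ, true_imp_iff,
      ← forall_and]
    refine forall_congr' fun i => ?_
    by_cases h : i ∈ S <;> simp [h, and_comm]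
  rw [Measure.map_apply hm ((MeasurableSet.univ_pi hs').prod (MeasurableSet.univ_pi ht')), hpre,
    Measure.prod_prod, Measure.pi_pi, Measure.pi_pi, Measure.pi_pi, Measure.pi_pi,
    ← Finset.prod_mul_distrib, ← Finset.prod_mul_distrib]
  refine Finset.prod_congr rfl fun i _ => ?_
  by_cases h : i ∈ S <;> simp [h, mul_comm]

/-- Replacing the coordinates in `S` by those of an independent copy preserves the law. -/
theorem measurePreserving_piecewise (S : Finset (Fin n)) :
    MeasurePreserving (fun p : (∀ i, Ω i) × (∀ i, Ω i) => S.piecewise p.2 p.1)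
      ((Measure.pi μ).prod (Measure.pi μ)) (Measure.pi μ) :=
  measurePreserving_fst.comp (measurePreserving_swap μ S)

theorem lintegral_resample {F : (∀ i, Ω i) → ℝ≥0∞} (hF : Measurable F) (S : Finset (Fin n)) :
    ∫⁻ w, F w ∂(Measure.pi μ) =
      ∫⁻ w, ∫⁻ w', F (S.piecewise w' w) ∂(Measure.pi μ) ∂(Measure.pi μ) := by
  rw [← (measurePreserving_piecewise μ S).lintegral_comp hF, lintegral_prod _ (by
    exact (hF.comp (measurable_finset_piecewise S)).aemeasurable)]

theorem integral_resample {F : (∀ i, Ω i) → ℝ} (hF : Integrable F (Measure.pi μ))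
    (S : Finset (Fin n)) :
    ∫ w, F w ∂(Measure.pi μ) =
      ∫ w, ∫ w', F (S.piecewise w' w) ∂(Measure.pi μ) ∂(Measure.pi μ) := by
  have h := measurePreserving_piecewise μ S
  rw [← integral_prod (fun p : (∀ i, Ω i) × (∀ i, Ω i) => F (S.piecewise p.2 p.1))
    (h.integrable_comp_of_integrable hF), ← integral_map h.measurable.aemeasurable
      (by rw [h.map_eq]; exact hF.aestronglyMeasurable), h.map_eq]

/-- An integrable function whose coordinate increments have bounded conditional means is
bounded. -/
theorem ae_enorm_le_of_increments {g : (∀ i, Ω i) → ℂ} (hg : Measurable g) {C : ℝ≥0∞}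
    (h : ∀ᵐ z ∂(Measure.pi μ), ∀ i,
      ∫⁻ w, ‖g z - g (Function.update z i (w i))‖ₑ ∂(Measure.pi μ) ≤ C) :
    ∀ᵐ z ∂(Measure.pi μ), ‖g z‖ₑ ≤ (∫⁻ w, ‖g w‖ₑ ∂(Measure.pi μ)) + n * C := by
  have hupd : ∀ z : ∀ i, Ω i, ∀ S : Finset (Fin n), Measurable fun w => S.piecewise w z :=
    fun z S => (measurable_finset_piecewise S).comp measurable_prodMk_left
  have key : ∀ S : Finset (Fin n), ∀ᵐ z ∂(Measure.pi μ),
      ∫⁻ w, ‖g z - g (S.piecewise w z)‖ₑ ∂(Measure.pi μ) ≤ S.card * C := by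
    intro S
    induction S using Finset.induction_on with
    | empty => simp
    | insert i S hi ih =>
      -- The partly resampled point has law `⨂ μ_i`, so the almost sure hypothesis holds there too.
      have h2 := Measure.ae_ae_of_ae_prod
        ((measurePreserving_piecewise μ S).quasiMeasurePreserving.ae h)
      filter_upwards [ih, h2] with z h1 h2
      have hstep : ∫⁻ w, ‖g (S.piecewise w z) - g ((insert i S).piecewise w z)‖ₑ
          ∂(Measure.pi μ) ≤ C := by
        -- Coordinate `i` is redrawn from a fresh `w'`. Since `i ∉ S`, the base point does not see
        -- it, and the inner integral is the one bounded by the hypothesis.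
        rw [lintegral_resample μ (by
          exact ((hg.comp (hupd z S)).sub (hg.comp (hupd z (insert i S)))).enorm) {i}]
        calc _ ≤ ∫⁻ w : (∀ i, Ω i), C ∂(Measure.pi μ) := by
              refine lintegral_mono_ae ?_
              filter_upwards [h2] with w hw
              refine le_trans (le_of_eq ?_) (hw i)
              refine lintegral_congr fun w' => ?_
              rw [Finset.piecewise_insert, finset_piecewise_singleton_update S hi]
              simp
          _ = C := by simp
      calc _ ≤ ∫⁻ w, (‖g z - g (S.piecewise w z)‖ₑ +
              ‖g (S.piecewise w z) - g ((insert i S).piecewise w z)‖ₑ) ∂(Measure.pi μ) := by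
            refine lintegral_mono fun w => ?_
            rw [← sub_add_sub_cancel (g z) (g (S.piecewise w z)) (g ((insert i S).piecewise w z))]
            exact enorm_add_le _ _
        _ = _ + _ := lintegral_add_left (measurable_const.sub (hg.comp (hupd z S))).enorm _
        _ ≤ S.card * C + C := add_le_add h1 hstep
        _ = _ := by rw [Finset.card_insert_of_notMem hi]; push_cast; ring
  filter_upwards [key Finset.univ] with z hz
  simp only [Finset.piecewise_univ, Finset.card_univ, Fintype.card_fin] at hz
  calc ‖g z‖ₑ = ∫⁻ _ : (∀ i, Ω i), ‖g z‖ₑ ∂(Measure.pi μ) := by simp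
    _ ≤ ∫⁻ w, (‖g w‖ₑ + ‖g z - g w‖ₑ) ∂(Measure.pi μ) := by
        refine lintegral_mono fun w => ?_
        calc ‖g z‖ₑ = ‖g w + (g z - g w)‖ₑ := by congr 1; ring
          _ ≤ _ := enorm_add_le _ _
    _ = _ + _ := lintegral_add_left hg.enorm _
    _ ≤ _ := by gcongr

end Resampling

/-! ### Shapley weights and their balanced sums. -/

section Shapley

/-- The weight, in the Shapley formula, of a set of `k` players among `n - 1`. -/
noncomputable def shapleyWeight (n k : ℕ) : ℝ := ((n : ℝ) * ((n - 1).choose k : ℝ))⁻¹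

theorem shapleyWeight_nonneg (n k : ℕ) : 0 ≤ shapleyWeight n k := by
  unfold shapleyWeight; positivity

theorem choose_mul_shapleyWeight {n k : ℕ} (hk : k < n) :
    (n.choose k : ℝ) * shapleyWeight n k = ((n - k : ℕ) : ℝ)⁻¹ := by
  obtain ⟨m, rfl⟩ : ∃ m, n = m + 1 := ⟨n - 1, by omega⟩
  have h2 := Nat.choose_mul_succ_eq m k
  have hpos : (0 : ℝ) < (m.choose k : ℝ) := by exact_mod_cast Nat.choose_pos (by omega)
  have hpos2 : (0 : ℝ) < ((m + 1 - k : ℕ) : ℝ) := by exact_mod_cast (by omega)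
  have h3 : (m.choose k : ℝ) * ((m + 1 : ℕ) : ℝ) =
      ((m + 1).choose k : ℝ) * ((m + 1 - k : ℕ) : ℝ) := by exact_mod_cast h2
  rw [shapleyWeight, Nat.add_sub_cancel]
  field_simp
  linarith

theorem choose_pred_mul_shapleyWeight {n k : ℕ} (hk : k < n) :
    ((n - 1).choose k : ℝ) * shapleyWeight n k = (n : ℝ)⁻¹ := by
  have hpos : (0 : ℝ) < ((n - 1).choose k : ℝ) := by exact_mod_cast Nat.choose_pos (by omega)
  rw [shapleyWeight]
  field_simp

/-- Consecutive Shapley weights balance. -/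
theorem shapleyWeight_balance {n k : ℕ} (hk : k + 1 < n) :
    ((n - (k + 1) : ℕ) : ℝ) * shapleyWeight n (k + 1) = ((k + 1 : ℕ) : ℝ) * shapleyWeight n k := by
  obtain ⟨m, rfl⟩ : ∃ m, n = m + 1 := ⟨n - 1, by omega⟩
  have h := Nat.choose_succ_right_eq m k
  have hpos : (0 : ℝ) < (m.choose k : ℝ) := by exact_mod_cast Nat.choose_pos (by omega)
  have hpos' : (0 : ℝ) < (m.choose (k + 1) : ℝ) := by exact_mod_cast Nat.choose_pos (by omega)
  have h3 : (m.choose (k + 1) : ℝ) * ((k + 1 : ℕ) : ℝ) =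
      (m.choose k : ℝ) * ((m - k : ℕ) : ℝ) := by exact_mod_cast h
  have e : m + 1 - (k + 1) = m - k := by omega
  simp only [shapleyWeight, Nat.add_sub_cancel, e]
  field_simp
  linarith

theorem sum_sum_notMem_comm {n : ℕ} {E : Type*} [AddCommMonoid E]
    (F : Finset (Fin n) → Fin n → E) :
    ∑ i, ∑ S ∈ Finset.univ.filter (fun S : Finset (Fin n) => i ∉ S), F S i =
      ∑ S : Finset (Fin n), ∑ i ∈ Sᶜ, F S i := by
  refine Finset.sum_comm' ?_
  simp

/-- Efficiency of the Shapley value. -/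
theorem sub_eq_sum_shapleyWeight {n : ℕ} {E : Type*} [AddCommGroup E] [Module ℝ E]
    (F : Finset (Fin n) → E) :
    F ∅ - F Finset.univ =
      ∑ S : Finset (Fin n), ∑ i ∈ Sᶜ, shapleyWeight n S.card • (F S - F (insert i S)) := by
  rcases Nat.eq_zero_or_pos n with rfl | hn
  · rw [Subsingleton.elim (Finset.univ : Finset (Fin 0)) ∅, sub_self]
    exact (Finset.sum_eq_zero fun S _ => Finset.sum_eq_zero fun i _ => i.elim0).symm
  have h1 : ∑ S : Finset (Fin n), ∑ i ∈ Sᶜ, shapleyWeight n S.card • F (insert i S) =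
      ∑ T : Finset (Fin n), ∑ i ∈ T, shapleyWeight n (T.card - 1) • F T := by
    rw [Finset.sum_sigma', Finset.sum_sigma']
    refine Finset.sum_bij' (fun p _ => ⟨insert p.2 p.1, p.2⟩) (fun p _ => ⟨p.1.erase p.2, p.2⟩)
      ?_ ?_ ?_ ?_ ?_
    · simp
    · simp
    · rintro ⟨S, i⟩ h
      simp only [Finset.mem_sigma, Finset.mem_univ, Finset.mem_compl, true_and] at h
      simp [h]
    · rintro ⟨S, i⟩ h
      simp only [Finset.mem_sigma, Finset.mem_univ, true_and] at h
      simp [h]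
    · rintro ⟨S, i⟩ h
      simp only [Finset.mem_sigma, Finset.mem_univ, Finset.mem_compl, true_and] at h
      simp [h]
  -- Terms are collected by set. `shapleyWeight_balance` cancels every coefficient except those of
  -- `∅` and `univ`; there the truncated `0 - 1` and the weight at `card = n` are multiplied by
  -- zero.
  have h2 : ∑ S : Finset (Fin n), ∑ i ∈ Sᶜ, shapleyWeight n S.card • (F S - F (insert i S)) =
      ∑ S : Finset (Fin n), (((Sᶜ.card : ℝ) * shapleyWeight n S.card -
        (S.card : ℝ) * shapleyWeight n (S.card - 1)) • F S) := by
    simp only [smul_sub, Finset.sum_sub_distrib]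
    rw [h1, ← Finset.sum_sub_distrib]
    refine Finset.sum_congr rfl fun S _ => ?_
    rw [Finset.sum_const, Finset.sum_const, sub_smul, mul_smul, mul_smul, Nat.cast_smul_eq_nsmul,
      Nat.cast_smul_eq_nsmul]
  have hne : (∅ : Finset (Fin n)) ≠ Finset.univ := by
    intro h
    have := congrArg Finset.card h
    simp at this
    omega
  have hn0 : (n : ℝ) ≠ 0 := by positivity
  rw [h2, ← Finset.sum_subset (Finset.subset_univ {∅, Finset.univ}), Finset.sum_pair hne]
  · have e1 : ((∅ᶜ : Finset (Fin n)).card : ℝ) * shapleyWeight n (∅ : Finset (Fin n)).card -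
        ((∅ : Finset (Fin n)).card : ℝ) * shapleyWeight n ((∅ : Finset (Fin n)).card - 1) = 1 := by
      simp [shapleyWeight, hn0]
    have e2 : ((Finset.univᶜ : Finset (Fin n)).card : ℝ) *
        shapleyWeight n (Finset.univ : Finset (Fin n)).card -
        ((Finset.univ : Finset (Fin n)).card : ℝ) *
          shapleyWeight n ((Finset.univ : Finset (Fin n)).card - 1) = -1 := by
      simp [shapleyWeight, hn0]
    rw [e1, e2, one_smul, neg_smul, one_smul, sub_eq_add_neg]
  · intro S _ hS
    simp only [Finset.mem_insert, Finset.mem_singleton, not_or] at hS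
    have hc1 : 0 < S.card := Finset.card_pos.2 (Finset.nonempty_iff_ne_empty.2 hS.1)
    have hc2 : S.card < n := by
      have := Finset.card_lt_univ_of_notMem (s := S) (x := (Sᶜ).min' (by
        rw [← Finset.card_pos, Finset.card_compl]
        have := (Finset.card_lt_iff_ne_univ S).2 hS.2
        omega)) (Finset.mem_compl.1 (Finset.min'_mem _ _))
      simpa using this
    obtain ⟨k, hk⟩ : ∃ k, S.card = k + 1 := ⟨S.card - 1, by omega⟩
    have hb := shapleyWeight_balance (n := n) (k := k) (by omega)
    rw [Finset.card_compl, Fintype.card_fin, hk, hb]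
    simp

/-- Each term is at most `2(√(j+1) - √j)`, and these telescope. -/
theorem sum_inv_sqrt_le (n : ℕ) :
    ∑ j ∈ Finset.range n, (√((j + 1 : ℕ) : ℝ))⁻¹ ≤ 2 * √(n : ℝ) := by
  induction n with
  | zero => simp
  | succ n ih =>
    rw [Finset.sum_range_succ]
    have h1 : (√((n + 1 : ℕ) : ℝ))⁻¹ ≤ 2 * √((n + 1 : ℕ) : ℝ) - 2 * √(n : ℝ) := by
      have hx : 0 < √((n + 1 : ℕ) : ℝ) := Real.sqrt_pos.2 (by positivity)
      have hy : 0 ≤ √(n : ℝ) := Real.sqrt_nonneg _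
      have hx2 : √((n + 1 : ℕ) : ℝ) ^ 2 = n + 1 := by
        rw [Real.sq_sqrt (by positivity)]; push_cast; ring
      have hy2 : √(n : ℝ) ^ 2 = n := Real.sq_sqrt (by positivity)
      rw [inv_le_iff_one_le_mul₀' hx]
      nlinarith [sq_nonneg (√((n + 1 : ℕ) : ℝ) - √(n : ℝ))]
    linarith

theorem sum_range_inv_sqrt_sub_le (n : ℕ) :
    ∑ k ∈ Finset.range n, (√((n - k : ℕ) : ℝ))⁻¹ ≤ 2 * √(n : ℝ) := by
  rw [← Finset.sum_range_reflect]
  refine le_trans (le_of_eq (Finset.sum_congr rfl fun j hj => ?_)) (sum_inv_sqrt_le n)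
  have := Finset.mem_range.1 hj
  congr 4
  omega

/-- The weight that balances the two terms of the mean value trace inequality. -/
noncomputable def balanceWeight (n k : ℕ) : ℝ := √((n - k : ℕ) : ℝ) / √(n : ℝ)

theorem balanceWeight_pos {n k : ℕ} (hk : k < n) : 0 < balanceWeight n k := by
  have : 0 < n - k := by omega
  have : 0 < n := by omega
  unfold balanceWeight
  positivity

/-- The `n.choose k` sets of size `k` have total Shapley weight `1/(n - k)`, which the balance
factor turns into `n^{-1/2} (n - k)^{-1/2}`. -/
theorem sum_shapleyWeight_mul_balanceWeight_le (n : ℕ) :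
    ∑ S ∈ Finset.univ.filter (fun S : Finset (Fin n) => S ≠ Finset.univ),
      shapleyWeight n S.card * balanceWeight n S.card ≤ 2 := by
  have h1 : ∑ S ∈ Finset.univ.filter (fun S : Finset (Fin n) => S ≠ Finset.univ),
      shapleyWeight n S.card * balanceWeight n S.card =
      ∑ S ∈ (Finset.univ : Finset (Fin n)).powerset,
        (fun k => if k < n then shapleyWeight n k * balanceWeight n k else 0) S.card := by
    rw [Finset.powerset_univ, Finset.sum_filter]
    refine Finset.sum_congr rfl fun S _ => ?_
    have : S ≠ Finset.univ ↔ S.card < n := by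
      rw [← Finset.card_lt_iff_ne_univ, Fintype.card_fin]
    simp only [this]
  rw [h1, Finset.sum_powerset_apply_card
    (fun k => if k < n then shapleyWeight n k * balanceWeight n k else 0), Finset.card_univ,
    Fintype.card_fin, Finset.sum_range_succ]
  rcases Nat.eq_zero_or_pos n with rfl | hn
  · simp
  have hs : 0 < √(n : ℝ) := Real.sqrt_pos.2 (by positivity)
  calc _ = ∑ k ∈ Finset.range n, (√(n : ℝ))⁻¹ * (√((n - k : ℕ) : ℝ))⁻¹ := by
        simp only [lt_irrefl, if_false, smul_zero, add_zero]
        refine Finset.sum_congr rfl fun k hk => ?_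
        have hk := Finset.mem_range.1 hk
        have hpos : (0 : ℝ) < ((n - k : ℕ) : ℝ) := by exact_mod_cast (by omega)
        have hsq : 0 < √((n - k : ℕ) : ℝ) := Real.sqrt_pos.2 hpos
        rw [if_pos hk, nsmul_eq_mul, ← mul_assoc, choose_mul_shapleyWeight hk, balanceWeight]
        nth_rewrite 1 [← Real.sq_sqrt hpos.le]
        field_simp
    _ ≤ (√(n : ℝ))⁻¹ * (2 * √(n : ℝ)) := by
        rw [← Finset.mul_sum]
        exact mul_le_mul_of_nonneg_left (sum_range_inv_sqrt_sub_le n) (by positivity)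
    _ = 2 := by field_simp

/-- Here the sets of size `k` avoiding `i` have total Shapley weight `1/n`, and the inverse factor
produces the same `n^{-1/2} (n - k)^{-1/2}`. -/
theorem sum_shapleyWeight_mul_inv_balanceWeight_le {n : ℕ} (i : Fin n) :
    ∑ S ∈ Finset.univ.filter (fun S : Finset (Fin n) => i ∉ S),
      shapleyWeight n S.card * (balanceWeight n S.card)⁻¹ ≤ 2 := by
  have h0 : Finset.univ.filter (fun S : Finset (Fin n) => i ∉ S) =
      ((Finset.univ : Finset (Fin n)).erase i).powerset := by
    ext S
    simp [Finset.subset_erase]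
  have hn : 0 < n := i.pos
  have hs : 0 < √(n : ℝ) := Real.sqrt_pos.2 (by positivity)
  have hnn : (n : ℝ) = √(n : ℝ) ^ 2 := (Real.sq_sqrt (by positivity)).symm
  rw [h0, Finset.sum_powerset_apply_card
    (fun k => shapleyWeight n k * (balanceWeight n k)⁻¹), Finset.card_erase_of_mem
    (Finset.mem_univ i), Finset.card_univ, Fintype.card_fin, Nat.sub_add_cancel hn]
  calc _ = ∑ k ∈ Finset.range n, (√(n : ℝ))⁻¹ * (√((n - k : ℕ) : ℝ))⁻¹ := by
        refine Finset.sum_congr rfl fun k hk => ?_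
        have hk := Finset.mem_range.1 hk
        have hpos : (0 : ℝ) < ((n - k : ℕ) : ℝ) := by exact_mod_cast (by omega)
        have hsq : 0 < √((n - k : ℕ) : ℝ) := Real.sqrt_pos.2 hpos
        rw [nsmul_eq_mul, ← mul_assoc, choose_pred_mul_shapleyWeight hk, balanceWeight]
        nth_rewrite 1 [hnn]
        field_simp
    _ ≤ (√(n : ℝ))⁻¹ * (2 * √(n : ℝ)) := by
        rw [← Finset.mul_sum]
        exact mul_le_mul_of_nonneg_left (sum_range_inv_sqrt_sub_le n) (by positivity)
    _ = 2 := by field_simp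

end Shapley

/-! ### Integrability and expectations of bounded random matrices. -/

section BoundedMatrices

variable {d : ℕ} {α : Type*} [MeasurableSpace α] {ν : Measure α}

/-- A bounded map into a finite-dimensional space stays in a compact ball, on which `Φ` is bounded.
All integrability of trace exponentials comes from this. -/
theorem integrable_of_continuous_comp [IsFiniteMeasure ν] {E : Type*} [NormedAddCommGroup E]
    [NormedSpace ℝ E] [FiniteDimensional ℝ E] {h : α → E} (hm : StronglyMeasurable h) {R : ℝ}
    (hR : ∀ x, ‖h x‖ ≤ R) {Φ : E → ℝ} (hΦ : Continuous Φ) : Integrable (fun x => Φ (h x)) ν := by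
  have : ProperSpace E := FiniteDimensional.proper ℝ E
  obtain ⟨B, hB⟩ := (isCompact_closedBall (0 : E) R).exists_bound_of_continuousOn hΦ.continuousOn
  exact Integrable.of_bound (hΦ.comp_stronglyMeasurable hm).aestronglyMeasurable B
    (Filter.Eventually.of_forall fun x => hB _ (by simpa using hR x))

theorem continuous_matrix_exp :
    Continuous (NormedSpace.exp : Matrix (Fin d) (Fin d) ℂ → Matrix (Fin d) (Fin d) ℂ) := by
  let _ : NormedAlgebra ℚ (Matrix (Fin d) (Fin d) ℂ) := NormedAlgebra.restrictScalars ℚ ℂ _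
  exact NormedSpace.exp_continuous

theorem integrable_re_trace_sub_sq_mul_exp [IsFiniteMeasure ν]
    {X Y Z : α → Matrix (Fin d) (Fin d) ℂ} {R : ℝ} (hX : StronglyMeasurable X)
    (hY : StronglyMeasurable Y) (hZ : StronglyMeasurable Z) (hXR : ∀ x, ‖X x‖ ≤ R)
    (hYR : ∀ x, ‖Y x‖ ≤ R) (hZR : ∀ x, ‖Z x‖ ≤ R) (θ : ℝ) (C : Matrix (Fin d) (Fin d) ℂ) :
    Integrable (fun x => ((X x - Y x) ^ 2 * NormedSpace.exp (θ • (Z x - C))).trace.re) ν := by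
  refine integrable_of_continuous_comp (h := fun x => (X x, Y x, Z x)) (R := R)
    (Φ := fun p : Matrix (Fin d) (Fin d) ℂ × Matrix (Fin d) (Fin d) ℂ × Matrix (Fin d) (Fin d) ℂ =>
      ((p.1 - p.2.1) ^ 2 * NormedSpace.exp (θ • (p.2.2 - C))).trace.re)
    (hX.prodMk (hY.prodMk hZ)) (fun x => ?_) ?_
  · exact max_le (hXR x) (max_le (hYR x) (hZR x))
  · have := continuous_matrix_exp (d := d)
    refine Complex.continuous_re.comp (Continuous.matrix_trace ?_)
    fun_prop

theorem integrable_re_trace_sub_mul_exp [IsFiniteMeasure ν]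
    {X Y Z : α → Matrix (Fin d) (Fin d) ℂ} {R : ℝ} (hX : StronglyMeasurable X)
    (hY : StronglyMeasurable Y) (hZ : StronglyMeasurable Z) (hXR : ∀ x, ‖X x‖ ≤ R)
    (hYR : ∀ x, ‖Y x‖ ≤ R) (hZR : ∀ x, ‖Z x‖ ≤ R) (θ : ℝ) (C : Matrix (Fin d) (Fin d) ℂ) :
    Integrable (fun x => ((X x - Y x) * NormedSpace.exp (θ • (Z x - C))).trace.re) ν := by
  refine integrable_of_continuous_comp (h := fun x => (X x, Y x, Z x)) (R := R)
    (Φ := fun p : Matrix (Fin d) (Fin d) ℂ × Matrix (Fin d) (Fin d) ℂ × Matrix (Fin d) (Fin d) ℂ =>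
      ((p.1 - p.2.1) * NormedSpace.exp (θ • (p.2.2 - C))).trace.re)
    (hX.prodMk (hY.prodMk hZ)) (fun x => ?_) ?_
  · exact max_le (hXR x) (max_le (hYR x) (hZR x))
  · have := continuous_matrix_exp (d := d)
    refine Complex.continuous_re.comp (Continuous.matrix_trace ?_)
    fun_prop

theorem integrable_re_trace_exp [IsFiniteMeasure ν]
    {Z : α → Matrix (Fin d) (Fin d) ℂ} {R : ℝ} (hZ : StronglyMeasurable Z)
    (hZR : ∀ x, ‖Z x‖ ≤ R) (θ : ℝ) (C : Matrix (Fin d) (Fin d) ℂ) :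
    Integrable (fun x => (NormedSpace.exp (θ • (Z x - C))).trace.re) ν := by
  refine integrable_of_continuous_comp (h := Z) (R := R)
    (Φ := fun p => (NormedSpace.exp (θ • (p - C))).trace.re) hZ hZR ?_
  have := continuous_matrix_exp (d := d)
  refine Complex.continuous_re.comp (Continuous.matrix_trace ?_)
  fun_prop

theorem entryIntegrable_of_bounded [IsFiniteMeasure ν] {X : α → Matrix (Fin d) (Fin d) ℂ} {R : ℝ}
    (hX : StronglyMeasurable X) (hXR : ∀ x, ‖X x‖ ≤ R) : EntryIntegrable ν X := by
  intro a b
  refine Integrable.of_bound (C := R) ?_ (Filter.Eventually.of_forall fun x =>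
    (norm_apply_le_norm _ a b).trans (hXR x))
  have : Continuous fun M : Matrix (Fin d) (Fin d) ℂ => M a b := by fun_prop
  exact (this.comp_stronglyMeasurable hX).aestronglyMeasurable

theorem re_trace_expect_mul {X : α → Matrix (Fin d) (Fin d) ℂ} (hX : EntryIntegrable ν X)
    (G : Matrix (Fin d) (Fin d) ℂ) :
    (expect ν X * G).trace.re = ∫ x, (X x * G).trace.re ∂ν := by
  have h : (expect ν X * G).trace = ∫ x, (X x * G).trace ∂ν := by
    simp only [Matrix.trace, Matrix.diag, Matrix.mul_apply, expect, Matrix.of_apply]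
    rw [integral_finsetSum _ fun a _ => integrable_finsetSum _ fun b _ => (hX a b).mul_const _]
    refine Finset.sum_congr rfl fun a _ => ?_
    rw [integral_finsetSum _ fun b _ => (hX a b).mul_const _]
    exact Finset.sum_congr rfl fun b _ => (integral_mul_const _ _).symm
  have hi : Integrable (fun x => (X x * G).trace) ν := by
    simp only [Matrix.trace, Matrix.diag, Matrix.mul_apply]
    exact integrable_finsetSum _ fun a _ => integrable_finsetSum _ fun b _ =>
      (hX a b).mul_const _
  rw [h]
  exact (integral_re hi).symm

theorem expect_const_sub [IsProbabilityMeasure ν] {X : α → Matrix (Fin d) (Fin d) ℂ}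
    (hX : EntryIntegrable ν X) (M : Matrix (Fin d) (Fin d) ℂ) :
    expect ν (fun x => M - X x) = M - expect ν X := by
  ext a b
  simp only [expect, Matrix.of_apply, Matrix.sub_apply]
  rw [integral_sub (integrable_const _) (hX a b)]
  simp

theorem isHermitian_expect {X : α → Matrix (Fin d) (Fin d) ℂ} (hX : ∀ x, (X x).IsHermitian) :
    (expect ν X).IsHermitian := by
  ext a b
  simp only [expect, Matrix.conjTranspose_apply, Matrix.of_apply, Complex.star_def]
  rw [← integral_conj]
  refine integral_congr_ae (Filter.Eventually.of_forall fun x => ?_)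
  exact (hX x).apply a b

theorem re_trace_sq_mul_exp_nonneg {M A : Matrix (Fin d) (Fin d) ℂ} (hM : M.IsHermitian)
    (hA : A.IsHermitian) : 0 ≤ (M ^ 2 * NormedSpace.exp A).trace.re := by
  obtain ⟨P, -, hP2, -, hA2⟩ := exists_spectral_resolution hA
  have := hA2 1
  rw [one_smul] at this
  rw [this, re_trace_sq_mul_diagonal_left hM hP2]
  exact Finset.sum_nonneg fun i _ => Finset.sum_nonneg fun j _ =>
    mul_nonneg (Real.exp_pos _).le (Complex.normSq_nonneg _)

theorem integral_add_mul_four {F₁ F₂ F₃ F₄ : α → ℝ} (h₁ : Integrable F₁ ν) (h₂ : Integrable F₂ ν)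
    (h₃ : Integrable F₃ ν) (h₄ : Integrable F₄ ν) (a b : ℝ) :
    ∫ x, ((a * F₁ x + a * F₂ x) + (b * F₃ x + b * F₄ x)) ∂ν =
      (a * ∫ x, F₁ x ∂ν + a * ∫ x, F₂ x ∂ν) + (b * ∫ x, F₃ x ∂ν + b * ∫ x, F₄ x ∂ν) := by
  have e : ∀ x, (a * F₁ x + a * F₂ x) + (b * F₃ x + b * F₄ x) =
      a * (F₁ x + F₂ x) + b * (F₃ x + F₄ x) := fun x => by ring
  simp only [e]
  have h₁₂ : Integrable (fun x => F₁ x + F₂ x) ν := h₁.add h₂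
  have h₃₄ : Integrable (fun x => F₃ x + F₄ x) ν := h₃.add h₄
  rw [integral_add (h₁₂.const_mul a) (h₃₄.const_mul b), integral_const_mul,
    integral_const_mul, integral_add h₁ h₂, integral_add h₃ h₄]
  ring

end BoundedMatrices

/-! ### Pointwise identities for exchanging coordinates. -/

theorem piecewise_swap_singleton {n : ℕ} {Ω : Fin n → Type*} {S : Finset (Fin n)}
    {i : Fin n} (hi : i ∉ S)
    (z w : ∀ i, Ω i) :
    S.piecewise (({i} : Finset (Fin n)).piecewise z w) (({i} : Finset (Fin n)).piecewise w z) =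
      (insert i S).piecewise w z := by
  ext j
  by_cases h : j ∈ S
  · have : j ≠ i := fun e => hi (e ▸ h)
    simp [h, this]
  · by_cases h' : j = i
    · subst h'; simp [h]
    · simp [h, h']

theorem insert_piecewise_swap_singleton {n : ℕ} {Ω : Fin n → Type*} {S : Finset (Fin n)}
    {i : Fin n} (hi : i ∉ S) (z w : ∀ i, Ω i) :
    (insert i S).piecewise (({i} : Finset (Fin n)).piecewise z w)
      (({i} : Finset (Fin n)).piecewise w z) = S.piecewise w z := by
  ext j
  by_cases h' : j = i
  · subst h'; simp [hi]
  · by_cases h : j ∈ S <;> simp [h, h']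

theorem insert_piecewise_swap {n : ℕ} {Ω : Fin n → Type*} {S : Finset (Fin n)}
    {i : Fin n} (hi : i ∉ S) (z w : ∀ i, Ω i) :
    (insert i S).piecewise (S.piecewise z w) (S.piecewise w z) = Function.update z i (w i) := by
  ext j
  by_cases h' : j = i
  · subst h'; simp [hi]
  · by_cases h : j ∈ S <;> simp [h, h']

theorem piecewise_swap {n : ℕ} {Ω : Fin n → Type*} (S : Finset (Fin n)) (z w : ∀ i, Ω i) :
    S.piecewise (S.piecewise z w) (S.piecewise w z) = z := by
  ext j
  by_cases h : j ∈ S <;> simp [h]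

theorem singleton_piecewise_eq_update {n : ℕ} {Ω : Fin n → Type*} (i : Fin n) (z w : ∀ i, Ω i) :
    ({i} : Finset (Fin n)).piecewise w z = Function.update z i (w i) := by
  ext j
  by_cases h : j = i
  · subst h; simp
  · simp [h]

/-! ### The exponential covariance inequality for bounded `f`. -/

section Core

variable {n d : ℕ} {Ω : Fin n → Type*} [∀ i, MeasurableSpace (Ω i)]
  {μ : ∀ i, Measure (Ω i)}
  {f : (∀ i, Ω i) → Matrix (Fin d) (Fin d) ℂ} {R v : ℝ} {C : Matrix (Fin d) (Fin d) ℂ}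

/-- `E tr ((f(z_S) - f(z_{S ∪ i}))² exp (θ (f(z) - C)))`, where `z_S` is `z` with the coordinates
in `S` resampled. -/
noncomputable def resampledEnergy (μ : ∀ i, Measure (Ω i))
    (f : (∀ i, Ω i) → Matrix (Fin d) (Fin d) ℂ) (C : Matrix (Fin d) (Fin d) ℂ) (θ : ℝ)
    (S : Finset (Fin n)) (i : Fin n) : ℝ :=
  ∫ p : (∀ i, Ω i) × (∀ i, Ω i), ((f (S.piecewise p.2 p.1) - f ((insert i S).piecewise p.2 p.1)) ^ 2
    * NormedSpace.exp (θ • (f p.1 - C))).trace.re ∂((Measure.pi μ).prod (Measure.pi μ))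

theorem resampledEnergy_nonneg (hherm : ∀ z, (f z).IsHermitian) (hC : C.IsHermitian) (θ : ℝ)
    (S : Finset (Fin n)) (i : Fin n) : 0 ≤ resampledEnergy μ f C θ S i :=
  integral_nonneg fun _ => re_trace_sq_mul_exp_nonneg ((hherm _).sub (hherm _))
    (((hherm _).sub hC).smul (IsSelfAdjoint.all θ))

variable [∀ i, IsProbabilityMeasure (μ i)]

theorem integral_comp_swap (S : Finset (Fin n)) {F : (∀ i, Ω i) × (∀ i, Ω i) → ℝ}
    (hF : Integrable F ((Measure.pi μ).prod (Measure.pi μ))) :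
    ∫ p, F (S.piecewise p.2 p.1, S.piecewise p.1 p.2) ∂((Measure.pi μ).prod (Measure.pi μ)) =
      ∫ p, F p ∂((Measure.pi μ).prod (Measure.pi μ)) := by
  have h := measurePreserving_swap μ S
  rw [← integral_map (φ := fun p : (∀ i, Ω i) × (∀ i, Ω i) =>
    (S.piecewise p.2 p.1, S.piecewise p.1 p.2)) h.measurable.aemeasurable
    (by rw [h.map_eq]; exact hF.aestronglyMeasurable), h.map_eq]

/-- Exchanging the coordinates in `S` moves the resampling from the increment to the exponential.
Given `z`, the increment at `i ∉ S` is then independent of the exponential, so the conditional means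
assemble into `2 V(f)(z)`. -/
theorem sum_resampledEnergy_le (hf : StronglyMeasurable f) (hR : ∀ z, ‖f z‖ ≤ R)
    (hherm : ∀ z, (f z).IsHermitian) (hC : C.IsHermitian)
    (hv : ∀ᵐ z ∂(Measure.pi μ),
      ‖Matrix.toEuclideanCLM (n := Fin d) (𝕜 := ℂ) (varianceMatrix μ f z)‖ ≤ v)
    (θ : ℝ) (S : Finset (Fin n)) :
    ∑ i ∈ Sᶜ, resampledEnergy μ f C θ S i ≤
      2 * v * ∫ z, (NormedSpace.exp (θ • (f z - C))).trace.re ∂(Measure.pi μ) := by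
  set P := (Measure.pi μ).prod (Measure.pi μ) with hP
  have hpm : ∀ T : Finset (Fin n), StronglyMeasurable
      fun p : (∀ i, Ω i) × (∀ i, Ω i) => f (T.piecewise p.2 p.1) := fun T =>
    hf.comp_measurable (measurable_finset_piecewise T)
  have hf1 : StronglyMeasurable fun p : (∀ i, Ω i) × (∀ i, Ω i) => f p.1 :=
    hf.comp_measurable measurable_fst
  have hupd : ∀ i, Measurable fun p : (∀ i, Ω i) × (∀ i, Ω i) =>
      Function.update p.1 i (p.2 i) := fun i => by
    simpa only [← singleton_piecewise_eq_update] using measurable_finset_piecewise {i}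
  have hint : ∀ i, Integrable (fun p : (∀ i, Ω i) × (∀ i, Ω i) =>
      (sqIncrement f i p.1 p.2 *
        NormedSpace.exp (θ • (f (S.piecewise p.2 p.1) - C))).trace.re) P := fun i =>
    integrable_re_trace_sub_sq_mul_exp hf1 (hf.comp_measurable (hupd i)) (hpm S)
      (fun _ => hR _) (fun _ => hR _) (fun _ => hR _) θ C
  have hswap : ∀ i ∈ Sᶜ, resampledEnergy μ f C θ S i =
      ∫ z, ∫ w, (sqIncrement f i z w *
        NormedSpace.exp (θ • (f (S.piecewise w z) - C))).trace.re ∂(Measure.pi μ)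
        ∂(Measure.pi μ) := by
    intro i hi
    rw [Finset.mem_compl] at hi
    rw [resampledEnergy, ← integral_comp_swap S (integrable_re_trace_sub_sq_mul_exp (hpm S)
      (hpm (insert i S)) hf1 (fun _ => hR _) (fun _ => hR _) (fun _ => hR _) θ C),
      ← integral_prod _ (hint i)]
    simp only [insert_piecewise_swap hi, piecewise_swap, sqIncrement]
  rw [Finset.sum_congr rfl hswap, ← integral_finsetSum _ fun i _ => (hint i).integral_prod_left]
  have hmp := measurePreserving_piecewise μ S
  have hE : Integrable (fun p : (∀ i, Ω i) × (∀ i, Ω i) =>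
      (NormedSpace.exp (θ • (f (S.piecewise p.2 p.1) - C))).trace.re) P :=
    integrable_re_trace_exp (hpm S) (fun _ => hR _) θ C
  have hm : ∫ z, (NormedSpace.exp (θ • (f z - C))).trace.re ∂(Measure.pi μ) =
      ∫ z, ∫ w, (NormedSpace.exp (θ • (f (S.piecewise w z) - C))).trace.re ∂(Measure.pi μ)
        ∂(Measure.pi μ) := by
    rw [← integral_prod _ hE, ← integral_map (φ := fun p : (∀ i, Ω i) × (∀ i, Ω i) =>
      S.piecewise p.2 p.1) (f := fun z => (NormedSpace.exp (θ • (f z - C))).trace.re)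
      hmp.measurable.aemeasurable (by
        rw [hmp.map_eq]; exact (integrable_re_trace_exp hf hR θ C).aestronglyMeasurable), hmp.map_eq]
  rw [hm, ← integral_const_mul]
  refine integral_mono_ae (integrable_finsetSum _ fun i _ => (hint i).integral_prod_left)
    (hE.integral_prod_left.const_mul _) ?_
  filter_upwards [hv] with z hz
  have hz1 : ∀ T : Finset (Fin n), StronglyMeasurable fun w : ∀ i, Ω i => f (T.piecewise w z) :=
    fun T => hf.comp_measurable ((measurable_finset_piecewise T).comp measurable_prodMk_left)
  have hz2 : ∀ i, StronglyMeasurable fun w : ∀ i, Ω i => f (Function.update z i (w i)) :=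
    fun i => hf.comp_measurable ((hupd i).comp measurable_prodMk_left)
  have hsq : ∀ i, EntryIntegrable (Measure.pi μ) fun w => sqIncrement f i z w := by
    intro i a b
    have hcont : Continuous fun M : Matrix (Fin d) (Fin d) ℂ => ((f z - M) ^ 2) a b := by fun_prop
    have hcr : Continuous fun M : Matrix (Fin d) (Fin d) ℂ => ‖((f z - M) ^ 2) a b‖ := by fun_prop
    have h := integrable_of_continuous_comp (ν := Measure.pi μ) (hz2 i) (fun _ => hR _) hcr
    exact (integrable_norm_iff (hcont.comp_stronglyMeasurable (hz2 i)).aestronglyMeasurable).1 h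
  -- For fixed `z` the increment depends only on `w i`, and the exponential only on `w j` with `j ∈
  -- S`; hence the squared increment may be replaced by its mean.
  have hres : ∀ i ∈ Sᶜ, ∫ w, (sqIncrement f i z w *
        NormedSpace.exp (θ • (f (S.piecewise w z) - C))).trace.re ∂(Measure.pi μ) =
      ∫ w, (expect (Measure.pi μ) (fun w' => sqIncrement f i z w') *
        NormedSpace.exp (θ • (f (S.piecewise w z) - C))).trace.re ∂(Measure.pi μ) := by
    intro i hi
    rw [Finset.mem_compl] at hi
    have hi' : Integrable (fun w => (sqIncrement f i z w *
        NormedSpace.exp (θ • (f (S.piecewise w z) - C))).trace.re) (Measure.pi μ) :=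
      integrable_re_trace_sub_sq_mul_exp stronglyMeasurable_const (hz2 i)
        (hz1 S) (fun _ => hR _) (fun _ => hR _) (fun _ => hR _) θ C
    rw [integral_resample μ hi' {i}]
    refine integral_congr_ae (Filter.Eventually.of_forall fun w => ?_)
    dsimp only
    rw [re_trace_expect_mul (hsq i)]
    simp only [finset_piecewise_singleton_update S hi, sqIncrement, Finset.mem_singleton,
      Finset.piecewise_eq_of_mem]
  have hAh : ∀ w : ∀ i, Ω i, (θ • (f (S.piecewise w z) - C)).IsHermitian := fun w =>
    ((hherm _).sub hC).smul (IsSelfAdjoint.all θ)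
  have hVint : ∀ i, Integrable (fun w => (expect (Measure.pi μ) (fun w' => sqIncrement f i z w') *
        NormedSpace.exp (θ • (f (S.piecewise w z) - C))).trace.re) (Measure.pi μ) := by
    intro i
    refine integrable_of_continuous_comp (Φ := fun M => (expect (Measure.pi μ)
      (fun w' => sqIncrement f i z w') * NormedSpace.exp (θ • (M - C))).trace.re)
      (hz1 S) (fun _ => hR _) ?_
    have := continuous_matrix_exp (d := d)
    refine Complex.continuous_re.comp (Continuous.matrix_trace ?_)
    fun_prop
  rw [Finset.sum_congr rfl hres, ← integral_finsetSum _ fun i _ => hVint i, ← integral_const_mul]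
  refine integral_mono (integrable_finsetSum _ fun i _ => hVint i)
    ((integrable_re_trace_exp (hz1 S) (fun _ => hR _) θ C).const_mul _) fun w => ?_
  dsimp only
  set G := NormedSpace.exp (θ • (f (S.piecewise w z) - C)) with hG
  -- The terms with `i ∈ S` are nonnegative, so adding them completes the sum to `2 V(f)(z)`.
  calc ∑ i ∈ Sᶜ, (expect (Measure.pi μ) (fun w' => sqIncrement f i z w') * G).trace.re
      ≤ ∑ i, (expect (Measure.pi μ) (fun w' => sqIncrement f i z w') * G).trace.re := by
        refine Finset.sum_le_sum_of_subset_of_nonneg (Finset.subset_univ _) fun i _ _ => ?_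
        rw [re_trace_expect_mul (hsq i)]
        exact integral_nonneg fun w' =>
          re_trace_sq_mul_exp_nonneg ((hherm _).sub (hherm _)) (hAh w)
    _ = 2 * (varianceMatrix μ f z * G).trace.re := by
        have h2 : (2 : ℂ) • varianceMatrix μ f z =
            ∑ i, expect (Measure.pi μ) (fun w' => sqIncrement f i z w') := by
          rw [varianceMatrix, smul_smul]
          norm_num
        have h3 : 2 * (varianceMatrix μ f z * G).trace.re =
            (((2 : ℂ) • varianceMatrix μ f z) * G).trace.re := by
          rw [Matrix.smul_mul, Matrix.trace_smul, smul_eq_mul]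
          simp
        rw [h3, h2, Finset.sum_mul, Matrix.trace_sum, Complex.re_sum]
    _ ≤ 2 * v * G.trace.re := by
        rw [mul_assoc]
        exact mul_le_mul_of_nonneg_left (re_trace_mul_exp_le (hAh w) hz) two_pos.le

/-- Exchanging `z^i` and `w^i` reverses the increment and moves the exponent to `z_{i}`, so twice
the left side is the integral of `tr U(exp A - exp B)`. The mean value trace inequality applies,
with `A - B` being `θ` times the increment at `∅`. -/
theorem integral_increment_le (hf : StronglyMeasurable f) (hR : ∀ z, ‖f z‖ ≤ R)
    (hherm : ∀ z, (f z).IsHermitian) (hC : C.IsHermitian) {θ s : ℝ} (hθ : 0 < θ) (hs : 0 < s)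
    {S : Finset (Fin n)} {i : Fin n} (hi : i ∉ S) :
    ∫ p : (∀ i, Ω i) × (∀ i, Ω i), ((f (S.piecewise p.2 p.1) - f ((insert i S).piecewise p.2 p.1))
      * NormedSpace.exp (θ • (f p.1 - C))).trace.re ∂((Measure.pi μ).prod (Measure.pi μ)) ≤
    θ / 4 * (s * resampledEnergy μ f C θ S i + s⁻¹ * resampledEnergy μ f C θ ∅ i) := by
  set P := (Measure.pi μ).prod (Measure.pi μ) with hP
  have hpm : ∀ T : Finset (Fin n), StronglyMeasurable
      fun p : (∀ i, Ω i) × (∀ i, Ω i) => f (T.piecewise p.2 p.1) := fun T =>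
    hf.comp_measurable (measurable_finset_piecewise T)
  have hf1 : StronglyMeasurable fun p : (∀ i, Ω i) × (∀ i, Ω i) => f p.1 :=
    hf.comp_measurable measurable_fst
  have hI1 : Integrable (fun p : (∀ i, Ω i) × (∀ i, Ω i) =>
      ((f (S.piecewise p.2 p.1) - f ((insert i S).piecewise p.2 p.1))
      * NormedSpace.exp (θ • (f p.1 - C))).trace.re) P :=
    integrable_re_trace_sub_mul_exp (hpm S) (hpm (insert i S)) hf1
      (fun _ => hR _) (fun _ => hR _) (fun _ => hR _) θ C
  have hI2 : Integrable (fun p : (∀ i, Ω i) × (∀ i, Ω i) =>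
      ((f ((insert i S).piecewise p.2 p.1) - f (S.piecewise p.2 p.1))
      * NormedSpace.exp (θ • (f (({i} : Finset (Fin n)).piecewise p.2 p.1) - C))).trace.re) P :=
    integrable_re_trace_sub_mul_exp (hpm (insert i S)) (hpm S) (hpm {i})
      (fun _ => hR _) (fun _ => hR _) (fun _ => hR _) θ C
  have hJ1 : ∀ T : Finset (Fin n), Integrable (fun p : (∀ i, Ω i) × (∀ i, Ω i) =>
      ((f (T.piecewise p.2 p.1) - f ((insert i T).piecewise p.2 p.1)) ^ 2
      * NormedSpace.exp (θ • (f p.1 - C))).trace.re) P := fun T =>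
    integrable_re_trace_sub_sq_mul_exp (hpm T) (hpm (insert i T)) hf1
      (fun _ => hR _) (fun _ => hR _) (fun _ => hR _) θ C
  have hJ2 : ∀ T : Finset (Fin n), Integrable (fun p : (∀ i, Ω i) × (∀ i, Ω i) =>
      ((f (T.piecewise p.2 p.1) - f ((insert i T).piecewise p.2 p.1)) ^ 2
      * NormedSpace.exp (θ • (f (({i} : Finset (Fin n)).piecewise p.2 p.1) - C))).trace.re) P :=
    fun T => integrable_re_trace_sub_sq_mul_exp (hpm T) (hpm (insert i T)) (hpm {i})
      (fun _ => hR _) (fun _ => hR _) (fun _ => hR _) θ C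
  have hE2 : ∀ T : Finset (Fin n), i ∉ T → ∫ p : (∀ i, Ω i) × (∀ i, Ω i),
      ((f (T.piecewise p.2 p.1) - f ((insert i T).piecewise p.2 p.1)) ^ 2
      * NormedSpace.exp (θ • (f (({i} : Finset (Fin n)).piecewise p.2 p.1) - C))).trace.re ∂P =
      resampledEnergy μ f C θ T i := by
    intro T hT
    rw [resampledEnergy, ← integral_comp_swap {i} (hJ1 T)]
    refine integral_congr_ae (Filter.Eventually.of_forall fun p => ?_)
    dsimp only
    rw [piecewise_swap_singleton hT, insert_piecewise_swap_singleton hT,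
      ← neg_sub (f ((insert i T).piecewise p.2 p.1)), neg_sq]
  have hI2' : ∫ p : (∀ i, Ω i) × (∀ i, Ω i),
      ((f ((insert i S).piecewise p.2 p.1) - f (S.piecewise p.2 p.1))
      * NormedSpace.exp (θ • (f (({i} : Finset (Fin n)).piecewise p.2 p.1) - C))).trace.re ∂P =
      ∫ p : (∀ i, Ω i) × (∀ i, Ω i),
      ((f (S.piecewise p.2 p.1) - f ((insert i S).piecewise p.2 p.1))
      * NormedSpace.exp (θ • (f p.1 - C))).trace.re ∂P := by
    rw [← integral_comp_swap {i} hI1]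
    refine integral_congr_ae (Filter.Eventually.of_forall fun p => ?_)
    dsimp only
    rw [piecewise_swap_singleton hi, insert_piecewise_swap_singleton hi]
  have hcomb : ∫ p, (4 * (((f (S.piecewise p.2 p.1) - f ((insert i S).piecewise p.2 p.1))
      * NormedSpace.exp (θ • (f p.1 - C))).trace.re +
      ((f ((insert i S).piecewise p.2 p.1) - f (S.piecewise p.2 p.1))
      * NormedSpace.exp (θ • (f (({i} : Finset (Fin n)).piecewise p.2 p.1) - C))).trace.re)) ∂P ≤
    ∫ p, ((θ * s * ((f (S.piecewise p.2 p.1) - f ((insert i S).piecewise p.2 p.1)) ^ 2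
      * NormedSpace.exp (θ • (f p.1 - C))).trace.re +
      θ * s * ((f (S.piecewise p.2 p.1) - f ((insert i S).piecewise p.2 p.1)) ^ 2
      * NormedSpace.exp (θ • (f (({i} : Finset (Fin n)).piecewise p.2 p.1) - C))).trace.re) +
      (θ * s⁻¹ * ((f ((∅ : Finset (Fin n)).piecewise p.2 p.1) -
        f ((insert i ∅ : Finset (Fin n)).piecewise p.2 p.1)) ^ 2
      * NormedSpace.exp (θ • (f p.1 - C))).trace.re +
      θ * s⁻¹ * ((f ((∅ : Finset (Fin n)).piecewise p.2 p.1) -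
        f ((insert i ∅ : Finset (Fin n)).piecewise p.2 p.1)) ^ 2
      * NormedSpace.exp (θ • (f (({i} : Finset (Fin n)).piecewise p.2 p.1) - C))).trace.re)) ∂P := by
    refine integral_mono ((hI1.add hI2).const_mul 4)
      ((((hJ1 S).const_mul _).add ((hJ2 S).const_mul _)).add
        (((hJ1 ∅).const_mul _).add ((hJ2 ∅).const_mul _))) fun p => ?_
    dsimp only
    set U := f (S.piecewise p.2 p.1) - f ((insert i S).piecewise p.2 p.1) with hU
    set A := θ • (f p.1 - C) with hA
    set B := θ • (f (({i} : Finset (Fin n)).piecewise p.2 p.1) - C) with hB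
    -- The parameter is `θ * s`: as `(A - B)² = θ² D²`, both resulting coefficients, `θ s` and `θ
    -- s⁻¹`, are linear in `θ`.
    have h := re_trace_mul_exp_sub_exp_le (U := U) (A := A) (B := B) ((hherm _).sub (hherm _))
      (((hherm _).sub hC).smul (IsSelfAdjoint.all θ))
      (((hherm _).sub hC).smul (IsSelfAdjoint.all θ)) (mul_pos hθ hs)
    have e0 : f ((insert i S).piecewise p.2 p.1) - f (S.piecewise p.2 p.1) = -U := by
      rw [hU, neg_sub]
    have e1 : (U * (NormedSpace.exp A - NormedSpace.exp B)).trace.re =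
        (U * NormedSpace.exp A).trace.re + (-U * NormedSpace.exp B).trace.re := by
      rw [mul_sub, neg_mul, Matrix.trace_sub, Matrix.trace_neg, Complex.sub_re, Complex.neg_re,
        sub_eq_add_neg]
    set D := f ((∅ : Finset (Fin n)).piecewise p.2 p.1) -
        f ((insert i ∅ : Finset (Fin n)).piecewise p.2 p.1) with hD
    have e2 : (A - B) ^ 2 = (θ ^ 2) • D ^ 2 := by
      have : A - B = θ • D := by
        rw [hA, hB, hD, ← smul_sub]
        rw [sub_sub_sub_cancel_right, Finset.piecewise_insert, Finset.piecewise_empty,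
          singleton_piecewise_eq_update]
      rw [this, smul_pow]
    have e3 : ∀ M : Matrix (Fin d) (Fin d) ℂ, (θ * s)⁻¹ * ((A - B) ^ 2 * M).trace.re =
        θ * s⁻¹ * (D ^ 2 * M).trace.re := by
      intro M
      rw [e2, Matrix.smul_mul, Matrix.trace_smul, Complex.smul_re, smul_eq_mul]
      field_simp
    rw [e1, e3, e3] at h
    rw [e0]
    exact h
  rw [integral_const_mul, integral_add hI1 hI2, hI2', integral_add_mul_four (hJ1 S) (hJ2 S)
    (hJ1 ∅) (hJ2 ∅), hE2 S hi,
    hE2 ∅ (Finset.notMem_empty i)] at hcomb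
  have hS : resampledEnergy μ f C θ S i = ∫ p : (∀ i, Ω i) × (∀ i, Ω i),
      ((f (S.piecewise p.2 p.1) - f ((insert i S).piecewise p.2 p.1)) ^ 2
      * NormedSpace.exp (θ • (f p.1 - C))).trace.re ∂P := rfl
  have h0 : resampledEnergy μ f C θ ∅ i = ∫ p : (∀ i, Ω i) × (∀ i, Ω i),
      ((f ((∅ : Finset (Fin n)).piecewise p.2 p.1) -
        f ((insert i ∅ : Finset (Fin n)).piecewise p.2 p.1)) ^ 2
      * NormedSpace.exp (θ • (f p.1 - C))).trace.re ∂P := rfl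
  rw [← hS, ← h0] at hcomb
  linarith

/-- The exponential covariance inequality
`E tr ((f - E f) exp (θ (f - C))) ≤ 2 v θ E tr exp (θ (f - C))`. -/
theorem integral_re_trace_mul_exp_le (hf : StronglyMeasurable f) (hR : ∀ z, ‖f z‖ ≤ R)
    (hherm : ∀ z, (f z).IsHermitian) (hC : C.IsHermitian)
    (hv : ∀ᵐ z ∂(Measure.pi μ),
      ‖Matrix.toEuclideanCLM (n := Fin d) (𝕜 := ℂ) (varianceMatrix μ f z)‖ ≤ v)
    {θ : ℝ} (hθ : 0 < θ) :
    ∫ z, ((f z - expect (Measure.pi μ) f) * NormedSpace.exp (θ • (f z - C))).trace.re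
      ∂(Measure.pi μ) ≤
    2 * v * θ * ∫ z, (NormedSpace.exp (θ • (f z - C))).trace.re ∂(Measure.pi μ) := by
  set P := (Measure.pi μ).prod (Measure.pi μ) with hP
  set m := ∫ z, (NormedSpace.exp (θ • (f z - C))).trace.re ∂(Measure.pi μ) with hm
  have hpm : ∀ T : Finset (Fin n), StronglyMeasurable
      fun p : (∀ i, Ω i) × (∀ i, Ω i) => f (T.piecewise p.2 p.1) := fun T =>
    hf.comp_measurable (measurable_finset_piecewise T)
  have hf1 : StronglyMeasurable fun p : (∀ i, Ω i) × (∀ i, Ω i) => f p.1 :=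
    hf.comp_measurable measurable_fst
  have hf2 : StronglyMeasurable fun p : (∀ i, Ω i) × (∀ i, Ω i) => f p.2 :=
    hf.comp_measurable measurable_snd
  have hint := entryIntegrable_of_bounded (ν := Measure.pi μ) hf hR
  have hI1 : ∀ S : Finset (Fin n), ∀ i, Integrable (fun p : (∀ i, Ω i) × (∀ i, Ω i) =>
      ((f (S.piecewise p.2 p.1) - f ((insert i S).piecewise p.2 p.1))
      * NormedSpace.exp (θ • (f p.1 - C))).trace.re) P := fun S i =>
    integrable_re_trace_sub_mul_exp (hpm S) (hpm (insert i S)) hf1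
      (fun _ => hR _) (fun _ => hR _) (fun _ => hR _) θ C
  have h1 : ∫ z, ((f z - expect (Measure.pi μ) f) * NormedSpace.exp (θ • (f z - C))).trace.re
      ∂(Measure.pi μ) = ∫ p : (∀ i, Ω i) × (∀ i, Ω i), ((f p.1 - f p.2) *
        NormedSpace.exp (θ • (f p.1 - C))).trace.re ∂P := by
    rw [integral_prod _ (integrable_re_trace_sub_mul_exp hf1 hf2 hf1
      (fun _ => hR _) (fun _ => hR _) (fun _ => hR _) θ C)]
    refine integral_congr_ae (Filter.Eventually.of_forall fun z => ?_)
    dsimp only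
    rw [← expect_const_sub hint, re_trace_expect_mul]
    intro a b
    exact (integrable_const _).sub (hint a b)
  have h2 : ∫ p : (∀ i, Ω i) × (∀ i, Ω i), ((f p.1 - f p.2) *
        NormedSpace.exp (θ • (f p.1 - C))).trace.re ∂P =
      ∑ S : Finset (Fin n), ∑ i ∈ Sᶜ, shapleyWeight n S.card *
        ∫ p : (∀ i, Ω i) × (∀ i, Ω i),
          ((f (S.piecewise p.2 p.1) - f ((insert i S).piecewise p.2 p.1))
            * NormedSpace.exp (θ • (f p.1 - C))).trace.re ∂P := by
    have e : ∀ p : (∀ i, Ω i) × (∀ i, Ω i), ((f p.1 - f p.2) *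
        NormedSpace.exp (θ • (f p.1 - C))).trace.re =
        ∑ S : Finset (Fin n), ∑ i ∈ Sᶜ, shapleyWeight n S.card *
          ((f (S.piecewise p.2 p.1) - f ((insert i S).piecewise p.2 p.1))
            * NormedSpace.exp (θ • (f p.1 - C))).trace.re := by
      intro p
      have := sub_eq_sum_shapleyWeight (fun S : Finset (Fin n) => f (S.piecewise p.2 p.1))
      simp only [Finset.piecewise_empty, Finset.piecewise_univ] at this
      rw [this, Finset.sum_mul, Matrix.trace_sum, Complex.re_sum]
      refine Finset.sum_congr rfl fun S _ => ?_
      rw [Finset.sum_mul, Matrix.trace_sum, Complex.re_sum]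
      refine Finset.sum_congr rfl fun i _ => ?_
      rw [Matrix.smul_mul, Matrix.trace_smul, Complex.smul_re, smul_eq_mul]
    simp only [e]
    rw [integral_finsetSum _ fun S _ => integrable_finsetSum _ fun i _ => (hI1 S i).const_mul _]
    refine Finset.sum_congr rfl fun S _ => ?_
    rw [integral_finsetSum _ fun i _ => (hI1 S i).const_mul _]
    exact Finset.sum_congr rfl fun i _ => integral_const_mul _ _
  have hJ := sum_resampledEnergy_le hf hR hherm hC hv θ
  have hJ0 : ∀ S i, 0 ≤ resampledEnergy μ f C θ S i := resampledEnergy_nonneg hherm hC θ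
  -- The sign of `v` is not assumed; it is enough that a sum of energies is nonnegative.
  have hvm : 0 ≤ 2 * v * m := le_trans (Finset.sum_nonneg fun i _ => hJ0 ∅ i) (hJ ∅)
  have h3 : ∀ S : Finset (Fin n), ∀ i ∈ Sᶜ, shapleyWeight n S.card *
        ∫ p : (∀ i, Ω i) × (∀ i, Ω i),
          ((f (S.piecewise p.2 p.1) - f ((insert i S).piecewise p.2 p.1))
            * NormedSpace.exp (θ • (f p.1 - C))).trace.re ∂P ≤
      θ / 4 * (shapleyWeight n S.card * balanceWeight n S.card * resampledEnergy μ f C θ S i) +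
      θ / 4 * (shapleyWeight n S.card * (balanceWeight n S.card)⁻¹ *
        resampledEnergy μ f C θ ∅ i) := by
    intro S i hi
    have hi' := Finset.mem_compl.1 hi
    have hlt : S.card < n := by simpa using Finset.card_lt_univ_of_notMem hi'
    have h := integral_increment_le (μ := μ) hf hR hherm hC hθ (balanceWeight_pos hlt) hi'
    refine (mul_le_mul_of_nonneg_left h (shapleyWeight_nonneg n S.card)).trans (le_of_eq ?_)
    ring
  rw [h1, h2]
  refine (Finset.sum_le_sum fun S _ => Finset.sum_le_sum fun i hi => h3 S i hi).trans ?_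
  simp only [Finset.sum_add_distrib, ← Finset.mul_sum]
  have h4 : ∑ S : Finset (Fin n), shapleyWeight n S.card * balanceWeight n S.card *
      ∑ i ∈ Sᶜ, resampledEnergy μ f C θ S i ≤ 2 * (2 * v * m) := by
    -- For `S = univ` the inner sum is empty.
    rw [← Finset.sum_filter_of_ne (p := fun S => S ≠ Finset.univ) (by
      rintro S - h rfl
      simp at h)]
    calc _ ≤ ∑ S ∈ Finset.univ.filter (fun S : Finset (Fin n) => S ≠ Finset.univ),
          shapleyWeight n S.card * balanceWeight n S.card * (2 * v * m) := by
          refine Finset.sum_le_sum fun S _ => mul_le_mul_of_nonneg_left (hJ S) ?_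
          refine mul_nonneg (shapleyWeight_nonneg _ _) ?_
          unfold balanceWeight
          positivity
      _ ≤ _ := by
          rw [← Finset.sum_mul]
          exact mul_le_mul_of_nonneg_right (sum_shapleyWeight_mul_balanceWeight_le n) hvm
  have h5 : ∑ S : Finset (Fin n), ∑ i ∈ Sᶜ, shapleyWeight n S.card *
      (balanceWeight n S.card)⁻¹ * resampledEnergy μ f C θ ∅ i ≤ 2 * (2 * v * m) := by
    rw [← sum_sum_notMem_comm (fun S i => shapleyWeight n S.card *
      (balanceWeight n S.card)⁻¹ * resampledEnergy μ f C θ ∅ i)]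
    simp only [← Finset.sum_mul]
    calc _ ≤ ∑ i, 2 * resampledEnergy μ f C θ ∅ i :=
          Finset.sum_le_sum fun i _ => mul_le_mul_of_nonneg_right
            (sum_shapleyWeight_mul_inv_balanceWeight_le i) (hJ0 ∅ i)
      _ ≤ _ := by
          rw [← Finset.mul_sum]
          have := hJ ∅
          rw [Finset.compl_empty] at this
          exact mul_le_mul_of_nonneg_left this two_pos.le
  simp only [← Finset.mul_sum] at h5
  -- Each half contributes `θ/4 · 4vm`, so the total is `2vθm`.
  nlinarith [mul_le_mul_of_nonneg_left h4 hθ.le, mul_le_mul_of_nonneg_left h5 hθ.le]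

end Core

/-! ### Matrix Laplace transform and its consequences for `lambdaMax`. -/

section Laplace

variable {d : ℕ}

theorem hasDerivAt_re_trace_exp_smul (X : Matrix (Fin d) (Fin d) ℂ) (θ : ℝ) :
    HasDerivAt (fun u : ℝ => (NormedSpace.exp (u • X)).trace.re)
      ((X * NormedSpace.exp (θ • X)).trace.re) θ := by
  let L : Matrix (Fin d) (Fin d) ℂ →L[ℝ] ℝ :=
    LinearMap.toContinuousLinearMap (Complex.reLm ∘ₗ Matrix.traceLinearMap (Fin d) ℝ ℂ)
  exact L.hasFDerivAt.comp_hasDerivAt θ (hasDerivAt_exp_smul_const' X θ)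

/-- The largest eigenvalue is the limit of the continuous functions `log tr exp(kY) / k`, which
exceed it by at most `log d / k`. -/
theorem aestronglyMeasurable_lambdaMax {α : Type*} [MeasurableSpace α] {ν : Measure α}
    (hd : 1 ≤ d) {Y : α → Matrix (Fin d) (Fin d) ℂ} (hY : AEStronglyMeasurable Y ν)
    (hherm : ∀ x, (Y x).IsHermitian) : AEStronglyMeasurable (fun x => lambdaMax (Y x)) ν := by
  have hcont : ∀ k : ℕ, Continuous fun M : Matrix (Fin d) (Fin d) ℂ =>
      (NormedSpace.exp ((k : ℝ) • M)).trace.re := fun k => by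
    have := continuous_matrix_exp (d := d)
    refine Complex.continuous_re.comp (Continuous.matrix_trace ?_)
    fun_prop
  refine aestronglyMeasurable_of_tendsto_ae (u := Filter.atTop)
    (f := fun (k : ℕ) x => Real.log ((NormedSpace.exp ((k : ℝ) • Y x)).trace.re) / k)
    (fun k => ?_) (Filter.Eventually.of_forall fun x => ?_)
  · have h := ((hcont k).comp_aestronglyMeasurable hY).aemeasurable
    exact ((Real.measurable_log.comp_aemeasurable h).div_const _).aestronglyMeasurable
  · have hd' : (0 : ℝ) < d := by exact_mod_cast hd
    have hlim : Filter.Tendsto (fun k : ℕ => lambdaMax (Y x) + Real.log d / k) Filter.atTop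
        (nhds (lambdaMax (Y x))) := by
      simpa using (tendsto_const_div_atTop_nhds_zero_nat (Real.log d)).const_add (lambdaMax (Y x))
    refine tendsto_of_tendsto_of_tendsto_of_le_of_le' tendsto_const_nhds hlim ?_ ?_
    · filter_upwards [Filter.eventually_gt_atTop 0] with k hk
      have hk' : (0 : ℝ) < k := by exact_mod_cast hk
      rw [le_div_iff₀ hk', Real.le_log_iff_exp_le
        ((Real.exp_pos _).trans_le (exp_lambdaMax_le_trace hd (hherm x) k)), mul_comm]
      exact exp_lambdaMax_le_trace hd (hherm x) k
    · filter_upwards [Filter.eventually_gt_atTop 0] with k hk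
      have hk' : (0 : ℝ) < k := by exact_mod_cast hk
      have hpos := (Real.exp_pos _).trans_le (exp_lambdaMax_le_trace hd (hherm x) k)
      rw [div_le_iff₀ hk', add_mul, div_mul_cancel₀ _ hk'.ne']
      calc _ ≤ Real.log (d * Real.exp (k * lambdaMax (Y x))) :=
            Real.log_le_log hpos (trace_exp_le_exp_lambdaMax hd (hherm x) hk'.le)
        _ = _ := by
            rw [Real.log_mul hd'.ne' (Real.exp_pos _).ne', Real.log_exp]
            ring

variable {n : ℕ} {Ω : Fin n → Type*} [∀ i, MeasurableSpace (Ω i)]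
  {μ : ∀ i, Measure (Ω i)} [∀ i, IsProbabilityMeasure (μ i)]
  {f : (∀ i, Ω i) → Matrix (Fin d) (Fin d) ℂ} {R v : ℝ}

theorem hasDerivAt_integral_re_trace_exp {α : Type*} [MeasurableSpace α] {ν : Measure α}
    [IsFiniteMeasure ν] {f : α → Matrix (Fin d) (Fin d) ℂ} {R : ℝ}
    (hf : StronglyMeasurable f) (hR : ∀ z, ‖f z‖ ≤ R) (C : Matrix (Fin d) (Fin d) ℂ) (θ : ℝ) :
    HasDerivAt (fun u : ℝ => ∫ z, (NormedSpace.exp (u • (f z - C))).trace.re ∂ν)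
      (∫ z, ((f z - C) * NormedSpace.exp (θ • (f z - C))).trace.re ∂ν) θ := by
  have hcont : Continuous fun p : ℝ × Matrix (Fin d) (Fin d) ℂ =>
      ((p.2 - C) * NormedSpace.exp (p.1 • (p.2 - C))).trace.re := by
    have := continuous_matrix_exp (d := d)
    refine Complex.continuous_re.comp (Continuous.matrix_trace ?_)
    fun_prop
  have : ProperSpace (Matrix (Fin d) (Fin d) ℂ) := FiniteDimensional.proper ℝ _
  obtain ⟨B, hB⟩ := ((isCompact_closedBall θ 1).prod
    (isCompact_closedBall (0 : Matrix (Fin d) (Fin d) ℂ) R)).exists_bound_of_continuousOn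
      hcont.continuousOn
  have hint : ∀ u : ℝ, Integrable (fun z => (NormedSpace.exp (u • (f z - C))).trace.re) ν :=
    fun u => integrable_re_trace_exp hf hR u C
  have hmeas : AEStronglyMeasurable
      (fun z => ((f z - C) * NormedSpace.exp (θ • (f z - C))).trace.re) ν :=
    (hcont.comp_stronglyMeasurable (stronglyMeasurable_const.prodMk hf)).aestronglyMeasurable
  have hbound : ∀ᵐ z ∂ν, ∀ u ∈ Metric.closedBall θ 1,
      ‖((f z - C) * NormedSpace.exp (u • (f z - C))).trace.re‖ ≤ B :=
    Filter.Eventually.of_forall fun z u hu => hB (u, f z) ⟨hu, by simpa using hR z⟩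
  have hderiv : ∀ᵐ z ∂ν, ∀ u ∈ Metric.closedBall θ 1,
      HasDerivAt (fun u : ℝ => (NormedSpace.exp (u • (f z - C))).trace.re)
        ((f z - C) * NormedSpace.exp (u • (f z - C))).trace.re u :=
    Filter.Eventually.of_forall fun z u _ => hasDerivAt_re_trace_exp_smul (f z - C) u
  exact (hasDerivAt_integral_of_dominated_loc_of_deriv_le
    (F := fun u z => (NormedSpace.exp (u • (f z - C))).trace.re)
    (F' := fun u z => ((f z - C) * NormedSpace.exp (u • (f z - C))).trace.re)
    (Metric.closedBall_mem_nhds θ one_pos)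
    (Filter.Eventually.of_forall fun u => (hint u).aestronglyMeasurable)
    (hint θ) hmeas hbound (integrable_const B) hderiv).2

/-- The matrix Laplace transform bound `E tr exp (θ (f - E f)) ≤ d exp (v θ²)`. -/
theorem integral_re_trace_exp_le (hf : StronglyMeasurable f) (hR : ∀ z, ‖f z‖ ≤ R)
    (hherm : ∀ z, (f z).IsHermitian)
    (hv : ∀ᵐ z ∂(Measure.pi μ),
      ‖Matrix.toEuclideanCLM (n := Fin d) (𝕜 := ℂ) (varianceMatrix μ f z)‖ ≤ v)
    {θ : ℝ} (hθ : 0 ≤ θ) :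
    ∫ z, (NormedSpace.exp (θ • (f z - expect (Measure.pi μ) f))).trace.re ∂(Measure.pi μ) ≤
      d * Real.exp (v * θ ^ 2) := by
  set m : ℝ → ℝ := fun u =>
    ∫ z, (NormedSpace.exp (u • (f z - expect (Measure.pi μ) f))).trace.re ∂(Measure.pi μ) with hm
  have hder : ∀ u, HasDerivAt m _ u := fun u =>
    hasDerivAt_integral_re_trace_exp (ν := Measure.pi μ) hf hR (expect (Measure.pi μ) f) u
  have hder2 : ∀ u, HasDerivAt (fun u : ℝ => Real.exp (-(v * u ^ 2)))
      (Real.exp (-(v * u ^ 2)) * (-(v * (2 * u)))) u := fun u => by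
    simpa using (((hasDerivAt_pow 2 u).const_mul v).neg).exp
  -- Grönwall's argument for `m' ≤ 2vu m`. The centring matrix is `E f` both in the factor and in
  -- the exponent, so the covariance inequality bounds exactly this derivative.
  have hanti : AntitoneOn (fun u => m u * Real.exp (-(v * u ^ 2))) (Set.Ici 0) := by
    apply antitoneOn_of_deriv_nonpos (convex_Ici 0)
    · exact fun u _ => ((hder u).mul (hder2 u)).continuousAt.continuousWithinAt
    · exact fun u _ => ((hder u).mul (hder2 u)).differentiableAt.differentiableWithinAt
    · intro u hu
      rw [interior_Ici, Set.mem_Ioi] at hu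
      have h := integral_re_trace_mul_exp_le hf hR hherm
        (isHermitian_expect (ν := Measure.pi μ) hherm) hv hu
      have e := ((hder u).mul (hder2 u)).deriv
      change deriv (m * fun u => Real.exp (-(v * u ^ 2))) u ≤ 0
      rw [e]
      have h' : _ ≤ 2 * v * u * m u := h
      nlinarith [Real.exp_pos (-(v * u ^ 2)),
        mul_le_mul_of_nonneg_right h' (Real.exp_pos (-(v * u ^ 2))).le]
  have h := hanti (Set.mem_Ici.2 le_rfl) (Set.mem_Ici.2 hθ) hθ
  have h0 : m 0 = d := by simp [hm, Matrix.trace_one]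
  simp only [h0] at h
  rw [Real.exp_neg] at h
  have hpos := Real.exp_pos (v * θ ^ 2)
  calc m θ = m θ * (Real.exp (v * θ ^ 2))⁻¹ * Real.exp (v * θ ^ 2) := by field_simp
    _ ≤ d * Real.exp (v * θ ^ 2) := by
        refine mul_le_mul_of_nonneg_right (h.trans (le_of_eq ?_)) hpos.le
        simp

theorem integrable_exp_lambdaMax (hd : 1 ≤ d) (hf : StronglyMeasurable f) (hR : ∀ z, ‖f z‖ ≤ R)
    (hherm : ∀ z, (f z).IsHermitian) (θ : ℝ) :
    Integrable (fun z => Real.exp (θ * lambdaMax (f z - expect (Measure.pi μ) f)))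
      (Measure.pi μ) := by
  have hX : ∀ z, (f z - expect (Measure.pi μ) f).IsHermitian := fun z =>
    (hherm z).sub (isHermitian_expect hherm)
  refine (integrable_re_trace_exp hf hR θ (expect (Measure.pi μ) f)).mono' ?_ ?_
  · have h := aestronglyMeasurable_lambdaMax (ν := Measure.pi μ) hd
      (hf.sub stronglyMeasurable_const).aestronglyMeasurable hX
    exact Real.continuous_exp.comp_aestronglyMeasurable (h.const_mul θ)
  · refine Filter.Eventually.of_forall fun z => ?_
    rw [Real.norm_of_nonneg (Real.exp_pos _).le]
    exact exp_lambdaMax_le_trace hd (hX z) θ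

theorem integral_exp_lambdaMax_le (hd : 1 ≤ d) (hf : StronglyMeasurable f) (hR : ∀ z, ‖f z‖ ≤ R)
    (hherm : ∀ z, (f z).IsHermitian)
    (hv : ∀ᵐ z ∂(Measure.pi μ),
      ‖Matrix.toEuclideanCLM (n := Fin d) (𝕜 := ℂ) (varianceMatrix μ f z)‖ ≤ v)
    {θ : ℝ} (hθ : 0 ≤ θ) :
    ∫ z, Real.exp (θ * lambdaMax (f z - expect (Measure.pi μ) f)) ∂(Measure.pi μ) ≤
      d * Real.exp (v * θ ^ 2) := by
  refine le_trans ?_ (integral_re_trace_exp_le hf hR hherm hv hθ)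
  exact integral_mono (integrable_exp_lambdaMax hd hf hR hherm θ)
    (integrable_re_trace_exp hf hR θ _) fun z =>
      exp_lambdaMax_le_trace hd ((hherm z).sub (isHermitian_expect hherm)) θ

theorem measure_lambdaMax_ge_le (hd : 1 ≤ d) (hf : StronglyMeasurable f) (hR : ∀ z, ‖f z‖ ≤ R)
    (hherm : ∀ z, (f z).IsHermitian)
    (hv : ∀ᵐ z ∂(Measure.pi μ),
      ‖Matrix.toEuclideanCLM (n := Fin d) (𝕜 := ℂ) (varianceMatrix μ f z)‖ ≤ v)
    {θ : ℝ} (hθ : 0 ≤ θ) (t : ℝ) :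
    (Measure.pi μ) {z | t ≤ lambdaMax (f z - expect (Measure.pi μ) f)} ≤
      ENNReal.ofReal (d * Real.exp (v * θ ^ 2 - θ * t)) := by
  have h := ProbabilityTheory.measure_ge_le_exp_mul_mgf (μ := Measure.pi μ) t hθ
    (integrable_exp_lambdaMax hd hf hR hherm θ)
  rw [← ofReal_measureReal]
  refine ENNReal.ofReal_le_ofReal (h.trans ?_)
  calc _ ≤ Real.exp (-θ * t) * (d * Real.exp (v * θ ^ 2)) :=
        mul_le_mul_of_nonneg_left (integral_exp_lambdaMax_le hd hf hR hherm hv hθ)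
          (Real.exp_pos _).le
    _ = _ := by
        rw [sub_eq_add_neg, Real.exp_add, neg_mul]
        ring

/-- Jensen's inequality in tangent form: `1 + x ≤ e^x` is integrated at `x = θ λ_max - c`, with
`e^c` equal to the bound on the exponential moment. -/
theorem integral_lambdaMax_le (hd : 1 ≤ d) (hf : StronglyMeasurable f) (hR : ∀ z, ‖f z‖ ≤ R)
    (hherm : ∀ z, (f z).IsHermitian)
    (hv : ∀ᵐ z ∂(Measure.pi μ),
      ‖Matrix.toEuclideanCLM (n := Fin d) (𝕜 := ℂ) (varianceMatrix μ f z)‖ ≤ v)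
    (hint : Integrable (fun z => lambdaMax (f z - expect (Measure.pi μ) f)) (Measure.pi μ))
    {θ : ℝ} (hθ : 0 < θ) :
    ∫ z, lambdaMax (f z - expect (Measure.pi μ) f) ∂(Measure.pi μ) ≤
      Real.log d / θ + v * θ := by
  have hd' : (0 : ℝ) < d := by exact_mod_cast hd
  set c := Real.log d + v * θ ^ 2 with hc
  have hexp : Real.exp c = d * Real.exp (v * θ ^ 2) := by
    rw [hc, Real.exp_add, Real.exp_log hd']
  have h1 : ∫ z, (θ * lambdaMax (f z - expect (Measure.pi μ) f) - c + 1) ∂(Measure.pi μ) ≤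
      ∫ z, Real.exp (-c) * Real.exp (θ * lambdaMax (f z - expect (Measure.pi μ) f))
        ∂(Measure.pi μ) := by
    refine integral_mono (((hint.const_mul θ).sub (integrable_const c)).add (integrable_const 1))
      ((integrable_exp_lambdaMax hd hf hR hherm θ).const_mul _) fun z => ?_
    dsimp only
    rw [← Real.exp_add, neg_add_eq_sub]
    exact Real.add_one_le_exp _
  have h2 : ∫ z, (θ * lambdaMax (f z - expect (Measure.pi μ) f) - c + 1) ∂(Measure.pi μ) =
      θ * (∫ z, lambdaMax (f z - expect (Measure.pi μ) f) ∂(Measure.pi μ)) - c + 1 := by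
    have hi : Integrable (fun z => θ * lambdaMax (f z - expect (Measure.pi μ) f) - c)
      (Measure.pi μ) := (hint.const_mul θ).sub (integrable_const c)
    rw [integral_add hi (integrable_const 1), integral_sub (hint.const_mul θ) (integrable_const c),
      integral_const_mul]
    simp
  rw [h2, integral_const_mul] at h1
  have h3 : Real.exp (-c) * ∫ z, Real.exp (θ * lambdaMax (f z - expect (Measure.pi μ) f))
        ∂(Measure.pi μ) ≤ 1 := by
    refine (mul_le_mul_of_nonneg_left (integral_exp_lambdaMax_le hd hf hR hherm hv hθ.le)
      (Real.exp_pos _).le).trans (le_of_eq ?_)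
    rw [← hexp, ← Real.exp_add]
    simp
  have h4 : θ * (∫ z, lambdaMax (f z - expect (Measure.pi μ) f) ∂(Measure.pi μ)) ≤ c := by linarith
  calc _ ≤ c / θ := (le_div_iff₀' hθ).2 h4
    _ = _ := by rw [hc]; field_simp

end Laplace

/-! ### Choice of the Laplace parameter, including degenerate cases. -/

section Optimization

/-- Optimizing the exponential tail bound over the Laplace parameter. -/
theorem le_tailBound {d : ℕ} (hd : 1 ≤ d) {v t : ℝ} (hv : 0 ≤ v) (ht : 0 ≤ t) {p : ℝ≥0∞}
    (hp1 : p ≤ 1)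
    (hp : ∀ θ : ℝ, 0 ≤ θ → p ≤ ENNReal.ofReal (d * Real.exp (v * θ ^ 2 - θ * t))) :
    p ≤ tailBound d (ENNReal.ofReal v) t := by
  have hd' : (0 : ℝ) < d := by exact_mod_cast hd
  rcases ht.eq_or_lt with rfl | ht
  -- At `t = 0` the exponent is zero for every `v`, so the bound is `d ≥ 1`.
  · refine hp1.trans ?_
    simpa [tailBound] using hd
  rcases hv.eq_or_lt with rfl | hv
  -- For `v = 0` and `t > 0` there is no minimizer; letting `θ → ∞` gives probability zero.
  · have hlim : Filter.Tendsto (fun θ : ℝ => ENNReal.ofReal (d * Real.exp (0 * θ ^ 2 - θ * t)))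
        Filter.atTop (nhds 0) := by
      rw [← ENNReal.ofReal_zero]
      refine ENNReal.tendsto_ofReal ?_
      have : Filter.Tendsto (fun θ : ℝ => 0 * θ ^ 2 - θ * t) Filter.atTop Filter.atBot := by
        refine (Filter.tendsto_neg_atTop_atBot.comp
          (Filter.tendsto_id.atTop_mul_const ht)).congr fun θ => ?_
        simp
      simpa using (Real.tendsto_exp_atBot.comp this).const_mul (d : ℝ)
    have hp0 : p ≤ 0 := ge_of_tendsto hlim (by
      filter_upwards [Filter.eventually_ge_atTop 0] with θ hθ using hp θ hθ)
    exact hp0.trans zero_le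
  -- This `θ` minimizes `vθ² - θt`.
  · refine (hp (t / (2 * v)) (by positivity)).trans (le_of_eq ?_)
    have e1 : ENNReal.ofReal (t ^ 2) / (4 * ENNReal.ofReal v) =
        ENNReal.ofReal (t ^ 2 / (4 * v)) := by
      rw [ENNReal.ofReal_div_of_pos (by positivity), ENNReal.ofReal_mul (by norm_num)]
      norm_num
    have e2 : v * (t / (2 * v)) ^ 2 - t / (2 * v) * t = -(t ^ 2 / (4 * v)) := by
      field_simp
      ring
    rw [tailBound, e1, e2, EReal.coe_ennreal_ofReal, max_eq_left (by positivity), ← EReal.coe_neg,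
      EReal.exp_coe, ENNReal.ofReal_mul hd'.le, ENNReal.ofReal_natCast]

theorem tailBound_top (d : ℕ) (t : ℝ) : tailBound d ⊤ t = d := by
  simp [tailBound, ENNReal.mul_top, ENNReal.div_top]

theorem le_two_mul_sqrt_of_forall {E L v : ℝ} (hL : 0 ≤ L) (hv : 0 ≤ v)
    (h : ∀ θ : ℝ, 0 < θ → E ≤ L / θ + v * θ) : E ≤ 2 * √(v * L) := by
  refine le_of_forall_pos_le_add fun ε hε => ?_
  rcases hv.eq_or_lt with rfl | hv
  · have := h ((L + 1) / ε) (by positivity)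
    have h2 : L / ((L + 1) / ε) ≤ ε := by
      rw [div_div_eq_mul_div, div_le_iff₀ (by positivity)]
      nlinarith
    simp only [zero_mul, Real.sqrt_zero, mul_zero, add_zero, zero_add] at this ⊢
    linarith
  rcases hL.eq_or_lt with rfl | hL
  · have := h (ε / v) (by positivity)
    have h2 : v * (ε / v) = ε := by field_simp
    simp only [mul_zero, Real.sqrt_zero, zero_div, zero_add] at this ⊢
    linarith
  · have hx : 0 < √L := Real.sqrt_pos.2 hL
    have hy : 0 < √v := Real.sqrt_pos.2 hv
    -- This `θ` equalizes the two terms. It is unavailable when `v` or `L` vanishes, hence the `ε`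
    -- argument above.
    have := h (√L / √v) (by positivity)
    have e1 : L / (√L / √v) = √v * √L := by
      rw [div_div_eq_mul_div, div_eq_iff hx.ne', mul_assoc, Real.mul_self_sqrt hL.le, mul_comm]
    have e2 : v * (√L / √v) = √v * √L := by
      rw [← mul_div_assoc, div_eq_iff hy.ne', mul_right_comm, Real.mul_self_sqrt hv.le]
    rw [Real.sqrt_mul hv.le]
    linarith

theorem coe_expectationBound (d : ℕ) {v : ℝ} (hv : 0 ≤ v) :
    (expectationBound d (ENNReal.ofReal v) : EReal) = ((2 * √(v * Real.log d) : ℝ) : EReal) := by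
  have hL : 0 ≤ Real.log d := Real.log_natCast_nonneg d
  have : expectationBound d (ENNReal.ofReal v) = ENNReal.ofReal (2 * √(v * Real.log d)) := by
    rw [expectationBound, ← ENNReal.ofReal_mul hv, ENNReal.ofReal_rpow_of_nonneg (by positivity)
      (by norm_num), Real.sqrt_eq_rpow, ENNReal.ofReal_mul (by norm_num)]
    norm_num
  rw [this, EReal.coe_ennreal_ofReal, max_eq_left (by positivity)]

end Optimization

/-! ### Reduction of integrable `f` to bounded `f`. -/

section Reduction

variable {d : ℕ}

theorem re_sqIncrement_apply {n : ℕ} {Ω : Fin n → Type*}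
    {f : (∀ i, Ω i) → Matrix (Fin d) (Fin d) ℂ} (hherm : ∀ z, (f z).IsHermitian) (i : Fin n)
    (z w : ∀ i, Ω i) (b : Fin d) : (sqIncrement f i z w b b).re =
      ∑ a, ‖f z a b - f (Function.update z i (w i)) a b‖ ^ 2 := by
  set D := f z - f (Function.update z i (w i)) with hD
  have hDh : D.IsHermitian := (hherm _).sub (hherm _)
  have e : sqIncrement f i z w = D ^ 2 := rfl
  rw [e, pow_two, Matrix.mul_apply, Complex.re_sum]
  refine Finset.sum_congr rfl fun a _ => ?_
  rw [← hDh.apply b a, ← Complex.normSq_eq_norm_sq, Complex.star_def,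
    ← Complex.normSq_eq_conj_mul_self, Complex.ofReal_re]
  rfl

theorem exists_norm_le_sum_norm_apply (d : ℕ) : ∃ c : ℝ, 0 ≤ c ∧
    ∀ A : Matrix (Fin d) (Fin d) ℂ, ‖A‖ ≤ ∑ a, ∑ b, ‖A a b‖ * c := by
  refine ⟨∑ a : Fin d, ∑ b : Fin d, ‖Matrix.single a b (1 : ℂ)‖, by positivity, fun A => ?_⟩
  conv_lhs => rw [Matrix.matrix_eq_sum_single A]
  refine (norm_sum_le _ _).trans (Finset.sum_le_sum fun a _ => (norm_sum_le _ _).trans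
    (Finset.sum_le_sum fun b _ => ?_))
  have e : Matrix.single a b (A a b) = A a b • Matrix.single a b (1 : ℂ) := by
    rw [Matrix.smul_single, smul_eq_mul, mul_one]
  rw [e, norm_smul]
  refine mul_le_mul_of_nonneg_left ?_ (norm_nonneg _)
  refine le_trans ?_ (Finset.single_le_sum
    (f := fun a : Fin d => ∑ b : Fin d, ‖Matrix.single a b (1 : ℂ)‖)
    (fun _ _ => Finset.sum_nonneg fun _ _ => norm_nonneg _) (Finset.mem_univ a))
  exact Finset.single_le_sum (f := fun b : Fin d => ‖Matrix.single a b (1 : ℂ)‖)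
    (fun _ _ => norm_nonneg _) (Finset.mem_univ b)

theorem stronglyMeasurable_of_apply {α : Type*} [MeasurableSpace α]
    {X : α → Matrix (Fin d) (Fin d) ℂ} (h : ∀ a b, StronglyMeasurable fun x => X x a b) :
    StronglyMeasurable X := by
  have e : X = fun x => ∑ a, ∑ b, X x a b • Matrix.single a b (1 : ℂ) := by
    funext x
    conv_lhs => rw [Matrix.matrix_eq_sum_single (X x)]
    simp only [Matrix.smul_single, smul_eq_mul, mul_one]
  rw [e]
  exact Finset.stronglyMeasurable_fun_sum _ fun a _ => Finset.stronglyMeasurable_fun_sum _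
    fun b _ => (h a b).smul_const _

/-- An entrywise integrable random Hermitian matrix has a version which is strongly measurable
and everywhere Hermitian. -/
theorem EntryIntegrable.exists_stronglyMeasurable {α : Type*} [MeasurableSpace α] {ν : Measure α}
    {f : α → Matrix (Fin d) (Fin d) ℂ} (hf : EntryIntegrable ν f)
    (hherm : ∀ z, (f z).IsHermitian) :
    ∃ g : α → Matrix (Fin d) (Fin d) ℂ, StronglyMeasurable g ∧ (∀ z, (g z).IsHermitian) ∧
      f =ᵐ[ν] g := by
  let M : α → Matrix (Fin d) (Fin d) ℂ := fun z => Matrix.of fun a b => (hf a b).1.mk _ z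
  have hM : StronglyMeasurable M := stronglyMeasurable_of_apply fun a b =>
    (hf a b).1.stronglyMeasurable_mk
  have hfM : f =ᵐ[ν] M := by
    have : ∀ᵐ z ∂ν, ∀ a b, f z a b = (hf a b).1.mk _ z :=
      ae_all_iff.2 fun a => ae_all_iff.2 fun b => (hf a b).1.ae_eq_mk
    filter_upwards [this] with z hz
    ext a b
    exact hz a b
  -- Entrywise versions need not be Hermitian off a null set; the Hermitian part is, and it agrees
  -- with `f` wherever `M` does.
  refine ⟨fun z => (1 / 2 : ℝ) • (M z + (M z)ᴴ), ?_, fun z => ?_, ?_⟩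
  · have hc : Continuous fun A : Matrix (Fin d) (Fin d) ℂ => (1 / 2 : ℝ) • (A + Aᴴ) := by fun_prop
    exact hc.comp_stronglyMeasurable hM
  · exact (Matrix.isHermitian_add_transpose_self (M z)).smul (IsSelfAdjoint.all _)
  · filter_upwards [hfM] with z hz
    rw [← hz, (hherm z).eq, ← two_smul ℝ, smul_smul]
    norm_num

theorem EntryIntegrable.aestronglyMeasurable {α : Type*} [MeasurableSpace α] {ν : Measure α}
    {f : α → Matrix (Fin d) (Fin d) ℂ} (hf : EntryIntegrable ν f)
    (hherm : ∀ z, (f z).IsHermitian) : AEStronglyMeasurable f ν :=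
  let ⟨g, hg, _, hfg⟩ := hf.exists_stronglyMeasurable hherm
  ⟨g, hg, hfg⟩

theorem integrable_lambdaMax_sub_expect {α : Type*} [MeasurableSpace α] {ν : Measure α}
    [IsProbabilityMeasure ν] (hd : 1 ≤ d) {f : α → Matrix (Fin d) (Fin d) ℂ}
    (hf : EntryIntegrable ν f) (hherm : ∀ z, (f z).IsHermitian) :
    Integrable (fun z => lambdaMax (f z - expect ν f)) ν := by
  obtain ⟨c, -, hc⟩ := exists_norm_le_sum_norm_apply d
  have hX : ∀ z, (f z - expect ν f).IsHermitian := fun z =>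
    (hherm z).sub (isHermitian_expect hherm)
  have hi : Integrable (fun z => ∑ a, ∑ b, ‖(f z - expect ν f) a b‖ * c) ν :=
    integrable_finsetSum _ fun a _ => integrable_finsetSum _ fun b _ =>
      (((hf a b).sub (integrable_const _)).norm).mul_const c
  refine hi.mono' (aestronglyMeasurable_lambdaMax hd
    ((hf.aestronglyMeasurable hherm).sub aestronglyMeasurable_const) hX)
    (Filter.Eventually.of_forall fun z => ?_)
  exact (abs_lambdaMax_le_norm hd (hX z)).trans (hc _)

variable {n : ℕ} {Ω : Fin n → Type*} [∀ i, MeasurableSpace (Ω i)]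
  {μ : ∀ i, Measure (Ω i)} {f g : (∀ i, Ω i) → Matrix (Fin d) (Fin d) ℂ} {v : ℝ}

theorem expect_congr_ae {α : Type*} [MeasurableSpace α] {ν : Measure α}
    {X Y : α → Matrix (Fin d) (Fin d) ℂ} (h : X =ᵐ[ν] Y) : expect ν X = expect ν Y := by
  ext a b
  exact integral_congr_ae (h.mono fun x hx => congrArg (fun M => M a b) hx)

/-- The squared entry is part of the `(b, b)` entry of the squared increment, whose mean is at most
`2 V(f)_{bb} ≤ 2v`. The `1` comes from `x ≤ 1 + x²`. -/
theorem lintegral_enorm_increment_le [∀ i, IsProbabilityMeasure (μ i)]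
    (hherm : ∀ z, (f z).IsHermitian) {z : ∀ i, Ω i}
    (hint : ∀ i, EntryIntegrable (Measure.pi μ) fun w => sqIncrement f i z w)
    (hv : ‖Matrix.toEuclideanCLM (n := Fin d) (𝕜 := ℂ) (varianceMatrix μ f z)‖ ≤ v)
    (i : Fin n) (a b : Fin d) :
    ∫⁻ w, ‖f z a b - f (Function.update z i (w i)) a b‖ₑ ∂(Measure.pi μ) ≤
      ENNReal.ofReal (1 + 2 * v) := by
  have hnn : ∀ j w, 0 ≤ (sqIncrement f j z w b b).re := fun j w => by
    rw [re_sqIncrement_apply hherm]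
    positivity
  have hre : ∀ j, ∫ w, (sqIncrement f j z w b b).re ∂(Measure.pi μ) =
      (expect (Measure.pi μ) (fun w => sqIncrement f j z w) b b).re := fun j =>
    integral_re (hint j b b)
  have hle : ∫ w, (sqIncrement f i z w b b).re ∂(Measure.pi μ) ≤ 2 * v := by
    calc _ ≤ ∑ j, ∫ w, (sqIncrement f j z w b b).re ∂(Measure.pi μ) :=
          Finset.single_le_sum (f := fun j => ∫ w, (sqIncrement f j z w b b).re ∂(Measure.pi μ))
            (fun j _ => integral_nonneg (hnn j)) (Finset.mem_univ i)
      _ = 2 * (varianceMatrix μ f z b b).re := by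
          simp only [hre, varianceMatrix, Matrix.smul_apply, Matrix.sum_apply, smul_eq_mul]
          rw [← Complex.re_sum]
          simp
      _ ≤ 2 * v := by
          have h := (norm_apply_le_norm (varianceMatrix μ f z) b b).trans
            ((Matrix.cstar_norm_def _).trans_le hv)
          have := (Complex.re_le_norm _).trans h
          linarith
  have hi : Integrable (fun w => 1 + (sqIncrement f i z w b b).re) (Measure.pi μ) :=
    (integrable_const 1).add (hint i b b).re
  calc _ ≤ ∫⁻ w, ENNReal.ofReal (1 + (sqIncrement f i z w b b).re) ∂(Measure.pi μ) := by
        refine lintegral_mono fun w => ?_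
        rw [← ofReal_norm]
        refine ENNReal.ofReal_le_ofReal ?_
        rw [re_sqIncrement_apply hherm]
        have : ‖f z a b - f (Function.update z i (w i)) a b‖ ^ 2 ≤
            ∑ a, ‖f z a b - f (Function.update z i (w i)) a b‖ ^ 2 :=
          Finset.single_le_sum
            (f := fun a => ‖f z a b - f (Function.update z i (w i)) a b‖ ^ 2)
            (fun _ _ => by positivity) (Finset.mem_univ a)
        nlinarith [sq_nonneg (‖f z a b - f (Function.update z i (w i)) a b‖ - 1)]
    _ = ENNReal.ofReal (∫ w, (1 + (sqIncrement f i z w b b).re) ∂(Measure.pi μ)) :=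
        (ofReal_integral_eq_lintegral_ofReal hi
          (Filter.Eventually.of_forall fun w => add_nonneg zero_le_one (hnn i w))).symm
    _ ≤ _ := by
        refine ENNReal.ofReal_le_ofReal ?_
        have hi' : Integrable (fun w => (sqIncrement f i z w b b).re) (Measure.pi μ) :=
          (hint i b b).re
        rw [integral_add (integrable_const 1) hi', integral_const, probReal_univ, one_smul]
        linarith

variable [∀ i, IsProbabilityMeasure (μ i)]

/-- The updated point has law `⨂ μ_i` under the joint law of `(z, w)`, so null sets pull back to
null sets, and Fubini slices them. -/
theorem ae_ae_update_eq {β : Type*} {f g : (∀ i, Ω i) → β} (h : f =ᵐ[Measure.pi μ] g) :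
    ∀ᵐ z ∂(Measure.pi μ), ∀ i, ∀ᵐ w ∂(Measure.pi μ),
      f (Function.update z i (w i)) = g (Function.update z i (w i)) := by
  refine ae_all_iff.2 fun i => ?_
  have := Measure.ae_ae_of_ae_prod
    ((measurePreserving_piecewise μ {i}).quasiMeasurePreserving.ae h)
  simpa only [singleton_piecewise_eq_update] using this

theorem varianceMatrix_congr_ae (h : f =ᵐ[Measure.pi μ] g) :
    varianceMatrix μ f =ᵐ[Measure.pi μ] varianceMatrix μ g := by
  filter_upwards [h, ae_ae_update_eq h] with z h1 h2
  unfold varianceMatrix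
  congr 1
  refine Finset.sum_congr rfl fun i _ => expect_congr_ae ?_
  filter_upwards [h2 i] with w hw
  rw [sqIncrement, sqIncrement, h1, hw]

/-- A random Hermitian matrix with an essentially bounded variance proxy is essentially bounded. -/
theorem exists_bounded_version (hherm : ∀ z, (f z).IsHermitian)
    (hf : EntryIntegrable (Measure.pi μ) f)
    (hint : ∀ᵐ z ∂(Measure.pi μ), ∀ i,
      EntryIntegrable (Measure.pi μ) (fun w => sqIncrement f i z w))
    (hv : ∀ᵐ z ∂(Measure.pi μ),
      ‖Matrix.toEuclideanCLM (n := Fin d) (𝕜 := ℂ) (varianceMatrix μ f z)‖ ≤ v) :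
    ∃ (g : (∀ i, Ω i) → Matrix (Fin d) (Fin d) ℂ) (R : ℝ), StronglyMeasurable g ∧
      (∀ z, ‖g z‖ ≤ R) ∧ (∀ z, (g z).IsHermitian) ∧ f =ᵐ[Measure.pi μ] g := by
  obtain ⟨N, hN, hNh, hfN⟩ := hf.exists_stronglyMeasurable hherm
  have happ : ∀ a b, StronglyMeasurable fun z => N z a b := fun a b => by
    have : Continuous fun M : Matrix (Fin d) (Fin d) ℂ => M a b := by fun_prop
    exact this.comp_stronglyMeasurable hN
  have hinc : ∀ a b, ∀ᵐ z ∂(Measure.pi μ), ∀ i,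
      ∫⁻ w, ‖N z a b - N (Function.update z i (w i)) a b‖ₑ ∂(Measure.pi μ) ≤
        ENNReal.ofReal (1 + 2 * v) := by
    intro a b
    filter_upwards [hint, hv, hfN, ae_ae_update_eq hfN] with z h1 h2 h3 h4 i
    refine le_trans (le_of_eq (lintegral_congr_ae ?_))
      (lintegral_enorm_increment_le hherm h1 h2 i a b)
    filter_upwards [h4 i] with w hw
    rw [h3, hw]
  have hbd : ∀ a b, ∃ K : ℝ, ∀ᵐ z ∂(Measure.pi μ), ‖N z a b‖ ≤ K := by
    intro a b
    have h := ae_enorm_le_of_increments μ (happ a b).measurable (hinc a b)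
    have hfin : (∫⁻ w, ‖N w a b‖ₑ ∂(Measure.pi μ)) + n * ENNReal.ofReal (1 + 2 * v) ≠ ⊤ := by
      refine ENNReal.add_ne_top.2 ⟨?_, ENNReal.mul_ne_top (by simp) (by simp)⟩
      have : Integrable (fun w => N w a b) (Measure.pi μ) :=
        (hf a b).congr (hfN.mono fun z hz => congrArg (fun M => M a b) hz)
      exact this.2.ne
    refine ⟨((∫⁻ w, ‖N w a b‖ₑ ∂(Measure.pi μ)) + n * ENNReal.ofReal (1 + 2 * v)).toReal,
      h.mono fun z hz => ?_⟩
    have := (ENNReal.toReal_le_toReal (by simp) hfin).2 hz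
    rwa [toReal_enorm] at this
  choose K hK using hbd
  obtain ⟨c, hc0, hc⟩ := exists_norm_le_sum_norm_apply d
  set R := max 0 (∑ a, ∑ b, K a b * c) with hR
  have hNR : ∀ᵐ z ∂(Measure.pi μ), ‖N z‖ ≤ R := by
    have : ∀ᵐ z ∂(Measure.pi μ), ∀ a b, ‖N z a b‖ ≤ K a b :=
      ae_all_iff.2 fun a => ae_all_iff.2 fun b => hK a b
    filter_upwards [this] with z hz
    refine (hc _).trans (le_trans ?_ (le_max_right _ _))
    exact Finset.sum_le_sum fun a _ => Finset.sum_le_sum fun b _ =>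
      mul_le_mul_of_nonneg_right (hz a b) hc0
  -- On the null set where the bound fails the matrix is set to zero, which is Hermitian; `R ≥ 0`
  -- keeps the bound valid there.
  refine ⟨Set.indicator {z | ‖N z‖ ≤ R} N, R, ?_, fun z => ?_, fun z => ?_, ?_⟩
  · exact hN.indicator (measurableSet_le hN.norm.measurable measurable_const)
  · by_cases h : ‖N z‖ ≤ R
    · rw [Set.indicator_of_mem (by exact h)]
      exact h
    · rw [Set.indicator_of_notMem (by exact h), norm_zero]
      exact le_max_left _ _
  · by_cases h : ‖N z‖ ≤ R
    · rw [Set.indicator_of_mem (by exact h)]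
      exact hNh z
    · rw [Set.indicator_of_notMem (by exact h)]
      exact Matrix.isHermitian_zero
  · filter_upwards [hfN, hNR] with z h1 h2
    rw [Set.indicator_of_mem (by exact h2), h1]

/-- Needed for `d = 1` and infinite `v`, where the convention `∞ · 0 = 0` makes the expectation
bound zero. -/
theorem integral_lambdaMax_fin_one {α : Type*} [MeasurableSpace α] {ν : Measure α}
    [IsProbabilityMeasure ν] {f : α → Matrix (Fin 1) (Fin 1) ℂ}
    (hf : EntryIntegrable ν f) (hherm : ∀ z, (f z).IsHermitian) :
    ∫ z, lambdaMax (f z - expect ν f) ∂ν = 0 := by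
  have e : ∀ z, lambdaMax (f z - expect ν f) = (f z 0 0 - ∫ x, f x 0 0 ∂ν).re := fun z =>
    lambdaMax_fin_one ((hherm z).sub (isHermitian_expect hherm))
  simp only [e]
  have h : ∫ z, (f z 0 0 - ∫ x, f x 0 0 ∂ν).re ∂ν = (∫ z, (f z 0 0 - ∫ x, f x 0 0 ∂ν) ∂ν).re :=
    integral_re ((hf 0 0).sub (integrable_const _))
  rw [h, integral_sub (hf 0 0) (integrable_const _)]
  simp

theorem expectationBound_top {d : ℕ} (hd : 2 ≤ d) : expectationBound d ⊤ = ⊤ := by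
  have : 0 < Real.log d := Real.log_pos (by exact_mod_cast hd)
  rw [expectationBound, ENNReal.top_mul (by simpa using this), ENNReal.top_rpow_of_pos (by norm_num)]
  simp

/-- Subgaussian concentration of the largest eigenvalue. -/
theorem lambdaMax_concentration (hd : 1 ≤ d) (hherm : ∀ z, (f z).IsHermitian)
    (hf : EntryIntegrable (Measure.pi μ) f)
    (hint : ∀ᵐ z ∂(Measure.pi μ), ∀ i,
      EntryIntegrable (Measure.pi μ) (fun w => sqIncrement f i z w)) :
    (∀ t : ℝ, 0 ≤ t → Measure.pi μ {z | t ≤ lambdaMax (f z - expect (Measure.pi μ) f)} ≤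
        tailBound d (varianceProxy μ f) t) ∧
      Integrable (fun z => lambdaMax (f z - expect (Measure.pi μ) f)) (Measure.pi μ) ∧
      ((∫ z, lambdaMax (f z - expect (Measure.pi μ) f) ∂(Measure.pi μ) : ℝ) : EReal) ≤
        (expectationBound d (varianceProxy μ f) : EReal) := by
  have hI := integrable_lambdaMax_sub_expect hd hf hherm
  by_cases htop : varianceProxy μ f = ⊤
  · refine ⟨fun t _ => ?_, hI, ?_⟩
    · rw [htop, tailBound_top]
      exact prob_le_one.trans (by exact_mod_cast hd)
    · rcases hd.eq_or_lt with rfl | hd2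
      · rw [integral_lambdaMax_fin_one hf hherm]
        exact EReal.coe_ennreal_nonneg _
      · rw [htop, expectationBound_top hd2]
        exact le_top
  set v := (varianceProxy μ f).toReal with hvdef
  have hv0 : 0 ≤ v := ENNReal.toReal_nonneg
  have hvp : varianceProxy μ f = ENNReal.ofReal v := (ENNReal.ofReal_toReal htop).symm
  have hv : ∀ᵐ z ∂(Measure.pi μ),
      ‖Matrix.toEuclideanCLM (n := Fin d) (𝕜 := ℂ) (varianceMatrix μ f z)‖ ≤ v := by
    filter_upwards [ENNReal.ae_le_essSup (μ := Measure.pi μ) (fun z =>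
      ‖Matrix.toEuclideanCLM (n := Fin d) (𝕜 := ℂ) (varianceMatrix μ f z)‖ₑ)] with z hz
    have := (ENNReal.toReal_le_toReal (by simp) htop).2 hz
    rwa [toReal_enorm] at this
  obtain ⟨g, R, hg, hgR, hgh, hfg⟩ := exists_bounded_version hherm hf hint hv
  have hvg : ∀ᵐ z ∂(Measure.pi μ),
      ‖Matrix.toEuclideanCLM (n := Fin d) (𝕜 := ℂ) (varianceMatrix μ g z)‖ ≤ v := by
    filter_upwards [hv, varianceMatrix_congr_ae hfg] with z h1 h2
    rwa [← h2]
  have hexp : expect (Measure.pi μ) f = expect (Measure.pi μ) g := expect_congr_ae hfg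
  have hlam : (fun z => lambdaMax (f z - expect (Measure.pi μ) f)) =ᵐ[Measure.pi μ]
      fun z => lambdaMax (g z - expect (Measure.pi μ) g) := by
    filter_upwards [hfg] with z hz
    rw [hz, hexp]
  rw [hvp]
  refine ⟨fun t ht => le_tailBound hd hv0 ht prob_le_one fun θ hθ => ?_, hI, ?_⟩
  · refine le_trans (le_of_eq (measure_congr ?_)) (measure_lambdaMax_ge_le hd hg hgR hgh hvg hθ t)
    filter_upwards [hlam] with z hz
    change (t ≤ _) = (t ≤ _)
    rw [hz]
  · rw [coe_expectationBound d hv0, integral_congr_ae hlam]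
    exact EReal.coe_le_coe_iff.2 (le_two_mul_sqrt_of_forall (Real.log_natCast_nonneg d) hv0
      fun θ hθ => integral_lambdaMax_le hd hg hgR hgh hvg (hI.congr hlam) hθ)

end Reduction

theorem expect_neg {d : ℕ} {α : Type*} [MeasurableSpace α] (ν : Measure α)
    (X : α → Matrix (Fin d) (Fin d) ℂ) : expect ν (fun x => -X x) = -expect ν X := by
  ext a b
  exact integral_neg _

theorem sqIncrement_neg {n d : ℕ} {Ω : Fin n → Type*}
    (f : (∀ i, Ω i) → Matrix (Fin d) (Fin d) ℂ) (i : Fin n) (z w : ∀ i, Ω i) :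
    sqIncrement (fun z => -f z) i z w = sqIncrement f i z w := by
  rw [sqIncrement, sqIncrement, ← neg_sq, neg_sub_neg, neg_sub]

theorem varianceProxy_neg {n d : ℕ} {Ω : Fin n → Type*} [∀ i, MeasurableSpace (Ω i)]
    (μ : ∀ i, Measure (Ω i)) (f : (∀ i, Ω i) → Matrix (Fin d) (Fin d) ℂ) :
    varianceProxy μ (fun z => -f z) = varianceProxy μ f := by
  simp only [varianceProxy, varianceMatrix, sqIncrement_neg]

end ProductMatrix

theorem corollary3p5 {n d : ℕ} (hd : 1 ≤ d)
    {Ω : Fin n → Type*} [∀ i, MeasurableSpace (Ω i)]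
    (μ : ∀ i, Measure (Ω i)) [∀ i, IsProbabilityMeasure (μ i)]
    (f : (∀ i, Ω i) → Matrix (Fin d) (Fin d) ℂ)
    (hf_herm : ∀ z, (f z).IsHermitian)
    (hf_int : ProductMatrix.EntryIntegrable (Measure.pi μ) f)
    (hV : ∀ᵐ z ∂(Measure.pi μ), ∀ i,
      ProductMatrix.EntryIntegrable (Measure.pi μ) (fun w => ProductMatrix.sqIncrement f i z w)) :
    (∀ t : ℝ, 0 ≤ t →
      Measure.pi μ {z | t ≤ ProductMatrix.lambdaMax (f z - ProductMatrix.expect (Measure.pi μ) f)}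
        ≤ ProductMatrix.tailBound d (ProductMatrix.varianceProxy μ f) t) ∧
    (Integrable (fun z => ProductMatrix.lambdaMax (f z - ProductMatrix.expect (Measure.pi μ) f))
        (Measure.pi μ) ∧
      ((∫ z, ProductMatrix.lambdaMax (f z - ProductMatrix.expect (Measure.pi μ) f)
          ∂(Measure.pi μ) : ℝ) : EReal)
        ≤ (ProductMatrix.expectationBound d (ProductMatrix.varianceProxy μ f) : EReal)) ∧
    (∀ t : ℝ, 0 ≤ t →
      Measure.pi μ {z | ProductMatrix.lambdaMin (f z - ProductMatrix.expect (Measure.pi μ) f) ≤ -t}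
        ≤ ProductMatrix.tailBound d (ProductMatrix.varianceProxy μ f) t) ∧
    (Integrable (fun z => ProductMatrix.lambdaMin (f z - ProductMatrix.expect (Measure.pi μ) f))
        (Measure.pi μ) ∧
      -(ProductMatrix.expectationBound d (ProductMatrix.varianceProxy μ f) : EReal)
        ≤ ((∫ z, ProductMatrix.lambdaMin (f z - ProductMatrix.expect (Measure.pi μ) f)
          ∂(Measure.pi μ) : ℝ) : EReal)) := by
  obtain ⟨h1, h2, h3⟩ := ProductMatrix.lambdaMax_concentration hd hf_herm hf_int hV
  -- Passing to `-f` exchanges the two extreme eigenvalues up to sign and leaves the squared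
  -- increments, hence the variance proxy, unchanged.
  obtain ⟨k1, k2, k3⟩ := ProductMatrix.lambdaMax_concentration (f := fun z => -f z) (μ := μ) hd
    (fun z => (hf_herm z).neg) (fun a b => (hf_int a b).neg)
    (by simpa only [ProductMatrix.sqIncrement_neg] using hV)
  have hmin : ∀ z, ProductMatrix.lambdaMin (f z - ProductMatrix.expect (Measure.pi μ) f) =
      -ProductMatrix.lambdaMax (-f z - ProductMatrix.expect (Measure.pi μ) (fun z => -f z)) := by
    intro z
    rw [ProductMatrix.lambdaMin_eq_neg, ProductMatrix.expect_neg, neg_sub, neg_sub_neg]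
  rw [ProductMatrix.varianceProxy_neg] at k1 k3
  refine ⟨h1, ⟨h2, h3⟩, fun t ht => ?_, ?_, ?_⟩
  · simpa only [hmin, neg_le_neg_iff] using k1 t ht
  · simp only [hmin]
    exact k2.neg
  · simp only [hmin]
    rw [integral_neg, EReal.coe_neg, EReal.neg_le_neg_iff]
    exact k3
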